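/- Let $\mathcal T$ be a triangulated category (satisfying the octahedral axiom). (A) Let $\mathcal H\subset\mathcal T$ be a full additive subcategory (closed under isomorphisms and finite direct sums, and containing $0$) such that $\operatorname{Hom}_{\mathcal T}(X,Y[-n])=0$ for all $X,Y\in\mathcal H$ and all $n>0$. Then the following are equivalent. 1. $\mathcal H$ is an abelian category which is hereditary (that is, $\operatorname{Ext}^i_{\mathcal H}(X,Y)=0$ for all $X,Y\in\mathcal H$ and $i\geq 2$), and the inclusion $\mathcal H\to\mathcal T$ can be lifted to a triangle equivalence $F\colon D^b(\mathcal H)\xrightarrow{\sim}\mathcal T$; that is, the composition of the canonical functor $\mathcal H\to D^b(\mathcal H)$ (complexes concentrated in degree $0$) with $F$ is naturally isomorphic to the inclusion. 2. $\operatorname{add}\big(\bigcup_{n\in\mathbb Z}\mathcal H[n]\big)=\mathcal T$; that is, every object of $\mathcal T$ is isomorphic to a finite direct sum of objects of the form $X[n]$ with $X\in\mathcal H$ and $n\in\mathbb Z$. 3. $\mathcal H=\mathcal T^{\geq 0}\cap\mathcal T^{\leq 0}$ is the heart of a split, bounded t-structure $(\mathcal T^{\geq 0},\mathcal T^{\leq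 0})$ on $\mathcal T$. Here, with $\mathcal T^{\geq n}=\mathcal T^{\geq 0}[-n]$ and $\mathcal T^{\leq n}=\mathcal T^{\leq 0}[-n]$, a t-structure is bounded if every object lies in $\mathcal T^{\geq -n}\cap\mathcal T^{\leq n}$ for some $n\ge 0$, and split if $\delta=0$ for every exact triangle $X\to X^+\xrightarrow{\delta}X^-\to X[1]$ with $X^+\in\mathcal T^{\geq 1}$ and $X^-\in\mathcal T^{\leq -1}$. (B) In particular, $\mathcal T$ is triangle equivalent to the bounded derived category of some hereditary abelian category if and only if $\mathcal T$ admits a split, bounded t-structure. -/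

import Mathlib

open CategoryTheory CategoryTheory.Limits CategoryTheory.Pretriangulated
open CategoryTheory.Triangulated

universe v' u' v u

namespace HereditaryDerived

/-- An abelian category is hereditary if all its Yoneda `Ext`-groups `Ext^i(X, Y)` with `i ≥ 2`
vanish, i.e. if every object has projective dimension at most one. -/
def IsHereditary (A : Type u) [Category.{v} A] [Abelian A] : Prop :=
  ∀ X : A, HasProjectiveDimensionLE X 1

/-- The bounded derived category `D^b(A)` of an abelian category `A`, i.e. the full subcategory
of bounded objects in the localization of cochain complexes at quasi-isomorphisms. -/
abbrev Db (A : Type u) [Category.{v} A] [Abelian A] : Type (max u v) :=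
  letI : HasDerivedCategory.{max u v} A := HasDerivedCategory.standard A
  DerivedCategory.Bounded A

/-- The canonical inclusion `A ⥤ D^b(A)`, as complexes concentrated in degree `0`. -/
noncomputable def Db.single (A : Type u) [Category.{v} A] [Abelian A] : A ⥤ Db A :=
  letI : HasDerivedCategory.{max u v} A := HasDerivedCategory.standard A
  (DerivedCategory.TStructure.t (C := A)).bounded.lift (DerivedCategory.singleFunctor A 0)
    (fun _ => ⟨⟨0, inferInstance⟩, ⟨0, inferInstance⟩⟩)

section

variable {T : Type u} [Category.{v} T] [Preadditive T] [HasZeroObject T] [HasShift T ℤ]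
  [∀ n : ℤ, (shiftFunctor T n).Additive] [Pretriangulated T]

/-- The functor `i : A ⥤ T` can be lifted to a triangle equivalence `D^b(A) ≌ T`: there is
an equivalence which is a triangle functor (it commutes with the shifts and preserves
distinguished triangles) and whose restriction along `A ⥤ D^b(A)` is isomorphic to `i`. -/
def LiftsToTriangleEquivalence {A : Type u'} [Category.{v'} A] [Abelian A] (i : A ⥤ T) : Prop :=
  ∃ (F : Db A ⥤ T) (_ : F.CommShift ℤ),
    F.IsTriangulated ∧ F.IsEquivalence ∧ Nonempty (Db.single A ⋙ F ≅ i)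

variable (T) in
/-- `T` is triangle equivalent to the bounded derived category of `A`. -/
def IsTriangleEquivalentToDb (A : Type u') [Category.{v'} A] [Abelian A] : Prop :=
  ∃ (F : Db A ⥤ T) (_ : F.CommShift ℤ), F.IsTriangulated ∧ F.IsEquivalence

/-- The union `⋃ₙ H[n]` of all the shifts of a full subcategory (up to isomorphism). -/
def unionShifts (H : ObjectProperty T) : ObjectProperty T :=
  fun X => ∃ (n : ℤ) (Y : T), H Y ∧ Nonempty (X ≅ Y⟦n⟧)

/-- The additive closure of a class of objects: all objects isomorphic to a finite
(possibly empty) direct sum of objects of the class. -/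
def addClosure (P : ObjectProperty T) : ObjectProperty T :=
  fun X => ∃ (k : ℕ) (Y : Fin k → T), (∀ i, P (Y i)) ∧ Nonempty (X ≅ ⨁ Y)

/-- A t-structure is split if in every distinguished triangle `X ⟶ X⁺ ⟶ X⁻ ⟶ X[1]` with
`X⁺ ∈ T^{>0}` and `X⁻ ∈ T^{<0}`, the morphism `X⁺ ⟶ X⁻` is zero. -/
def IsSplit (t : TStructure T) : Prop :=
  ∀ ⦃X Xp Xm : T⦄ (f : X ⟶ Xp) (δ : Xp ⟶ Xm) (g : Xm ⟶ X⟦(1 : ℤ)⟧),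
    Triangle.mk f δ g ∈ distTriang T → t.ge 1 Xp → t.le (-1) Xm → δ = 0

/-- A t-structure is bounded if every object lies in `T^{≥ -n} ∩ T^{≤ n}` for some `n`. -/
def IsBounded (t : TStructure T) : Prop :=
  ∀ X : T, ∃ n : ℕ, t.ge (-(n : ℤ)) X ∧ t.le (n : ℤ) X

end

end HereditaryDerived

/-! Under each condition every object of `T` is a finite direct sum of shifts of objects of the
heart, and the only possibly nonzero morphisms between shifts of heart objects have degree 0
(morphisms of the heart) or degree 1 (extensions). Such a triangulated category is determined by its
heart.

From 1 to 2: in the bounded derived category of a hereditary category, the connecting morphism of a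
truncation triangle lies in a group built from `Ext` groups of degree at least two. It vanishes
(`HomGap`, `homGap_of_heart`), truncation triangles split, and the shifts of the heart generate.
From 2 to 3: the t-structure is defined by orthogonality to shifts of `H` (`genTStructure`), and
truncating means sorting summands by degree.

From 3 to 1: a split t-structure satisfies `HomGap`. The derived category of the heart is compared
with `T` only through short exact sequences (`ExtRel`). Effaceability factors a Yoneda class of
degree two through two extensions, and its vanishing can then be tested in `T`
(`singleFunctor_hom_eq_zero`), so the heart is hereditary. Since `T` carries no enhancement, the
equivalence is built by hand: morphisms between shifted heart objects correspond when they come from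
the same morphism or the same short exact sequence (`ShiftRel`), and pairs of objects with a common
decomposition form a category `Matched` equivalent to both sides. Inverting one projection gives a
functor commuting with shifts that preserves the triangles of short exact sequences.

It remains to see that this functor is exact (`ExactOnHeart.isTriangulated`). Exactness is tested at
one morphism of a triangle and reduced to the heart by splitting the target; the key step,
`Splitting.exactAt`, corrects a lifted connecting morphism by a unipotent automorphism.

For (B), the image of the heart of the bounded derived category generates `T` without negative
extensions, so `genTStructure` applies; conversely the heart of the given t-structure serves. -/

namespace HereditaryDerived

open CategoryTheory.Category

universe w w'

set_option linter.unusedSectionVars false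

/-! ### Binary direct sums. -/

section Splitting

variable {C : Type u} [Category.{v} C] [Preadditive C]

/-- The data exhibiting an object as the direct sum of two others. -/
structure Splitting (Y Y₁ Y₂ : C) where
  /-- the inclusion of the first summand -/
  inl : Y₁ ⟶ Y
  /-- the inclusion of the second summand -/
  inr : Y₂ ⟶ Y
  /-- the projection to the first summand -/
  fst : Y ⟶ Y₁
  /-- the projection to the second summand -/
  snd : Y ⟶ Y₂
  inl_fst : inl ≫ fst = 𝟙 Y₁
  inr_snd : inr ≫ snd = 𝟙 Y₂
  inl_snd : inl ≫ snd = 0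
  inr_fst : inr ≫ fst = 0
  total : fst ≫ inl + snd ≫ inr = 𝟙 Y

namespace Splitting

attribute [simp] inl_fst inr_snd inl_snd inr_fst

variable {Y Y₁ Y₂ : C} (S : Splitting Y Y₁ Y₂)

@[simp]
lemma inl_fst_assoc {W : C} (f : Y₁ ⟶ W) : S.inl ≫ S.fst ≫ f = f := by
  rw [← assoc, S.inl_fst, id_comp]

@[simp]
lemma inr_snd_assoc {W : C} (f : Y₂ ⟶ W) : S.inr ≫ S.snd ≫ f = f := by
  rw [← assoc, S.inr_snd, id_comp]

@[simp]
lemma inl_snd_assoc {W : C} (f : Y₂ ⟶ W) : S.inl ≫ S.snd ≫ f = 0 := by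
  rw [← assoc, S.inl_snd, zero_comp]

@[simp]
lemma inr_fst_assoc {W : C} (f : Y₁ ⟶ W) : S.inr ≫ S.fst ≫ f = 0 := by
  rw [← assoc, S.inr_fst, zero_comp]

/-- The image of a splitting under an additive functor. -/
@[simps]
def map {D : Type u'} [Category.{v'} D] [Preadditive D] (F : C ⥤ D) [F.Additive] :
    Splitting (F.obj Y) (F.obj Y₁) (F.obj Y₂) where
  inl := F.map S.inl
  inr := F.map S.inr
  fst := F.map S.fst
  snd := F.map S.snd
  inl_fst := by rw [← F.map_comp, S.inl_fst, F.map_id]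
  inr_snd := by rw [← F.map_comp, S.inr_snd, F.map_id]
  inl_snd := by rw [← F.map_comp, S.inl_snd, F.map_zero]
  inr_fst := by rw [← F.map_comp, S.inr_fst, F.map_zero]
  total := by rw [← F.map_comp, ← F.map_comp, ← F.map_add, S.total, F.map_id]

/-- Exchange the two summands. -/
def symm : Splitting Y Y₂ Y₁ where
  inl := S.inr
  inr := S.inl
  fst := S.snd
  snd := S.fst
  inl_fst := S.inr_snd
  inr_snd := S.inl_fst
  inl_snd := S.inr_fst
  inr_fst := S.inl_snd
  total := by rw [add_comm]; exact S.total

lemma hom_ext {W : C} {f g : W ⟶ Y} (h₁ : f ≫ S.fst = g ≫ S.fst) (h₂ : f ≫ S.snd = g ≫ S.snd) :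
    f = g := by
  rw [← comp_id f, ← comp_id g, ← S.total, Preadditive.comp_add, Preadditive.comp_add,
    reassoc_of% h₁, reassoc_of% h₂]

lemma hom_ext' {W : C} {f g : Y ⟶ W} (h₁ : S.inl ≫ f = S.inl ≫ g) (h₂ : S.inr ≫ f = S.inr ≫ g) :
    f = g := by
  rw [← id_comp f, ← id_comp g, ← S.total, Preadditive.add_comp, Preadditive.add_comp,
    assoc, assoc, assoc, assoc, h₁, h₂]

end Splitting

end Splitting

/-! ### Distinguished triangles. -/

section Distinguished

variable {C : Type u} [Category.{v} C] [Preadditive C] [HasZeroObject C] [HasShift C ℤ]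
  [∀ n : ℤ, (shiftFunctor C n).Additive] [Pretriangulated C]

/-- The three morphisms `f`, `g`, `h` form a distinguished triangle. -/
abbrev Dist {X Y Z : C} (f : X ⟶ Y) (g : Y ⟶ Z) (h : Z ⟶ X⟦(1 : ℤ)⟧) : Prop :=
  Triangle.mk f g h ∈ distTriang C

namespace Dist

variable {X Y Z : C} {f : X ⟶ Y} {g : Y ⟶ Z} {h : Z ⟶ X⟦(1 : ℤ)⟧}

lemma of_iso (H : Dist f g h) {X' Y' Z' : C} {f' : X' ⟶ Y'} {g' : Y' ⟶ Z'}
    {h' : Z' ⟶ X'⟦(1 : ℤ)⟧} (e₁ : X' ≅ X) (e₂ : Y' ≅ Y) (e₃ : Z' ≅ Z)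
    (c₁ : f' ≫ e₂.hom = e₁.hom ≫ f) (c₂ : g' ≫ e₃.hom = e₂.hom ≫ g)
    (c₃ : h' ≫ e₁.hom⟦(1 : ℤ)⟧' = e₃.hom ≫ h) : Dist f' g' h' :=
  isomorphic_distinguished _ H _ (Triangle.isoMk _ _ e₁ e₂ e₃ c₁ c₂ c₃)

lemma comp₁₂ (H : Dist f g h) : f ≫ g = 0 := comp_distTriang_mor_zero₁₂ _ H

lemma comp₂₃ (H : Dist f g h) : g ≫ h = 0 := comp_distTriang_mor_zero₂₃ _ H

lemma comp₃₁ (H : Dist f g h) : h ≫ f⟦(1 : ℤ)⟧' = 0 := comp_distTriang_mor_zero₃₁ _ H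

lemma rot (H : Dist f g h) : Dist g h (-f⟦(1 : ℤ)⟧') := rot_of_distTriang _ H

lemma of_rot (H : Dist g h (-f⟦(1 : ℤ)⟧')) : Dist f g h :=
  (rotate_distinguished_triangle (Triangle.mk f g h)).2 H

lemma desc₂ (H : Dist f g h) {W : C} (φ : Y ⟶ W) (hφ : f ≫ φ = 0) : ∃ ψ : Z ⟶ W, φ = g ≫ ψ :=
  Triangle.yoneda_exact₂ _ H φ hφ

lemma desc₃ (H : Dist f g h) {W : C} (φ : Z ⟶ W) (hφ : g ≫ φ = 0) :
    ∃ ψ : X⟦(1 : ℤ)⟧ ⟶ W, φ = h ≫ ψ :=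
  Triangle.yoneda_exact₃ _ H φ hφ

lemma lift₁ (H : Dist f g h) {W : C} (φ : W ⟶ X⟦(1 : ℤ)⟧) (hφ : φ ≫ f⟦(1 : ℤ)⟧' = 0) :
    ∃ ψ : W ⟶ Z, φ = ψ ≫ h :=
  Triangle.coyoneda_exact₁ _ H φ hφ

lemma lift₂ (H : Dist f g h) {W : C} (φ : W ⟶ Y) (hφ : φ ≫ g = 0) : ∃ ψ : W ⟶ X, φ = ψ ≫ f :=
  Triangle.coyoneda_exact₂ _ H φ hφ

lemma lift₃ (H : Dist f g h) {W : C} (φ : W ⟶ Z) (hφ : φ ≫ h = 0) : ∃ ψ : W ⟶ Y, φ = ψ ≫ g :=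
  Triangle.coyoneda_exact₃ _ H φ hφ

section

variable {X' Y' Z' : C} {f' : X' ⟶ Y'} {g' : Y' ⟶ Z'} {h' : Z' ⟶ X'⟦(1 : ℤ)⟧}

lemma complete₃ (H : Dist f g h) (H' : Dist f' g' h') (a : X ⟶ X') (b : Y ⟶ Y')
    (comm : f ≫ b = a ≫ f') :
    ∃ c : Z ⟶ Z', g ≫ c = b ≫ g' ∧ h ≫ a⟦(1 : ℤ)⟧' = c ≫ h' :=
  complete_distinguished_triangle_morphism _ _ H H' a b comm

lemma complete₂ (H : Dist f g h) (H' : Dist f' g' h') (a : X ⟶ X') (c : Z ⟶ Z')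
    (comm : h ≫ a⟦(1 : ℤ)⟧' = c ≫ h') :
    ∃ b : Y ⟶ Y', f ≫ b = a ≫ f' ∧ g ≫ c = b ≫ g' :=
  complete_distinguished_triangle_morphism₂ _ _ H H' a c comm

lemma isIso₃ (H : Dist f g h) (H' : Dist f' g' h') (a : X ⟶ X') (b : Y ⟶ Y') (c : Z ⟶ Z')
    [ha : IsIso a] [hb : IsIso b]
    (c₁ : f ≫ b = a ≫ f') (c₂ : g ≫ c = b ≫ g') (c₃ : h ≫ a⟦(1 : ℤ)⟧' = c ≫ h') : IsIso c :=
  isIso₃_of_isIso₁₂ (Triangle.homMk (Triangle.mk f g h) (Triangle.mk f' g' h') a b c c₁ c₂ c₃)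
    H H' ha hb

end

/-- Two distinguished triangles with the same first morphism are isomorphic. -/
lemma exists_iso₃ (H : Dist f g h) {Z' : C} {g' : Y ⟶ Z'} {h' : Z' ⟶ X⟦(1 : ℤ)⟧}
    (H' : Dist f g' h') : ∃ e : Z ≅ Z', g ≫ e.hom = g' ∧ e.hom ≫ h' = h := by
  obtain ⟨c, hc₁, hc₂⟩ := H.complete₃ H' (𝟙 X) (𝟙 Y) (by simp)
  have := H.isIso₃ H' (𝟙 X) (𝟙 Y) c (by simp) hc₁ hc₂
  exact ⟨asIso c, by simpa using hc₁, by simpa using hc₂.symm⟩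

end Dist

lemma exists_dist₂₃ {X Y : C} (f : X ⟶ Y) :
    ∃ (Z : C) (g : Y ⟶ Z) (h : Z ⟶ X⟦(1 : ℤ)⟧), Dist f g h :=
  distinguished_cocone_triangle f

lemma exists_dist₁₃ {Y Z : C} (g : Y ⟶ Z) :
    ∃ (X : C) (f : X ⟶ Y) (h : Z ⟶ X⟦(1 : ℤ)⟧), Dist f g h :=
  distinguished_cocone_triangle₁ g

lemma exists_dist₁₂ {X Z : C} (h : Z ⟶ X⟦(1 : ℤ)⟧) :
    ∃ (Y : C) (f : X ⟶ Y) (g : Y ⟶ Z), Dist f g h :=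
  distinguished_cocone_triangle₂ h

lemma Splitting.dist {Y Y₁ Y₂ : C} (S : Splitting Y Y₁ Y₂) :
    Dist S.inl S.snd (0 : Y₂ ⟶ Y₁⟦(1 : ℤ)⟧) := by
  have H : Dist (biprod.inl : Y₁ ⟶ Y₁ ⊞ Y₂) biprod.snd (0 : Y₂ ⟶ Y₁⟦(1 : ℤ)⟧) :=
    binaryBiproductTriangle_distinguished Y₁ Y₂
  let e : Y ≅ Y₁ ⊞ Y₂ :=
    { hom := biprod.lift S.fst S.snd
      inv := biprod.desc S.inl S.inr
      hom_inv_id := by simp [S.total]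
      inv_hom_id := by ext <;> simp }
  refine H.of_iso (Iso.refl _) e (Iso.refl _) ?_ ?_ ?_
  · apply biprod.hom_ext <;> simp [e]
  · simp [e]
  · simp

/-- A distinguished triangle whose third morphism vanishes is a split one. -/
lemma Dist.exists_splitting {X Y Z : C} {f : X ⟶ Y} {g : Y ⟶ Z}
    (H : Dist f g (0 : Z ⟶ X⟦(1 : ℤ)⟧)) :
    ∃ S : Splitting Y X Z, S.inl = f ∧ S.snd = g := by
  obtain ⟨σ, hσ⟩ := H.lift₃ (𝟙 Z) comp_zero
  obtain ⟨ρ, hρ⟩ := H.lift₂ (𝟙 Y - g ≫ σ) (by simp [← hσ])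
  -- After a shift, a morphism killed by `f` factors through the connecting morphism, which is zero.
  have hmono : ∀ {W : C} (k : W ⟶ X), k ≫ f = 0 → k = 0 := by
    intro W k hk
    apply (shiftFunctor C (1 : ℤ)).map_injective
    obtain ⟨l, hl⟩ := H.lift₁ (k⟦(1 : ℤ)⟧') (by rw [← Functor.map_comp, hk, Functor.map_zero])
    rw [hl, comp_zero, Functor.map_zero]
  have hfg := H.comp₁₂
  refine ⟨⟨f, σ, ρ, g, ?_, hσ.symm, hfg, ?_, ?_⟩, rfl, rfl⟩
  · rw [← sub_eq_zero]
    apply hmono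
    rw [Preadditive.sub_comp, assoc, ← hρ, Preadditive.comp_sub, reassoc_of% hfg]
    simp
  · apply hmono
    rw [assoc, ← hρ, Preadditive.comp_sub, ← assoc, ← hσ]
    simp
  · rw [← hρ]; simp

end Distinguished

section

variable {C : Type u} [Category.{v} C] [Preadditive C] [HasZeroObject C] [HasShift C ℤ]
  [∀ n : ℤ, (shiftFunctor C n).Additive] [Pretriangulated C] [CategoryTheory.IsTriangulated C]

/-- The fibre of a morphism `f : X ⟶ Y` to a direct sum `Y = Y₁ ⊕ Y₂`, computed in two steps:
take the fibre `A` of the component `X ⟶ Y₂`, and then the fibre `Z` of the induced morphism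
`A ⟶ Y₁`. -/
lemma Splitting.exists_dist {X Y Y₁ Y₂ A Z : C} (S : Splitting Y Y₁ Y₂) (f : X ⟶ Y)
    {a : A ⟶ X} {b : Y₂ ⟶ A⟦(1 : ℤ)⟧} (h₁ : Dist a (f ≫ S.snd) b)
    {z : Z ⟶ A} {c : Y₁ ⟶ Z⟦(1 : ℤ)⟧} (h₂ : Dist z (a ≫ f ≫ S.fst) c) :
    ∃ h : Y ⟶ Z⟦(1 : ℤ)⟧, Dist (z ≫ a) f h ∧
      S.inl ≫ h = c ∧ h ≫ z⟦(1 : ℤ)⟧' = S.snd ≫ b := by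
  obtain ⟨Q, v, w, h₃⟩ := exists_dist₂₃ (z ≫ a)
  have O := someOctahedron rfl h₂ h₁ h₃
  -- The octahedron presents the cone `Q` as an extension of `Y₂` by `Y₁`. Its class factors through
  -- `b ≫ a⟦1⟧'` and so vanishes.
  have hba : b ≫ a⟦(1 : ℤ)⟧' = 0 := h₁.comp₃₁
  have hO := O.mem
  have hzero : b ≫ (a ≫ f ≫ S.fst)⟦(1 : ℤ)⟧' = 0 := by
    rw [Functor.map_comp, reassoc_of% hba, zero_comp]
  rw [hzero] at hO
  obtain ⟨S', hS'₁, hS'₂⟩ := Dist.exists_splitting hO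
  -- The octahedron identifies only the `Y₂`-component of `v` with that of `f`. The `Y₁`-components
  -- differ by a morphism through `f ≫ S.snd`, so the isomorphism `Q ≅ Y` is sheared by `d`.
  obtain ⟨d, hd⟩ := h₁.desc₂ (v ≫ S'.fst - f ≫ S.fst) (by
    rw [Preadditive.comp_sub, ← assoc, ← O.comm₁, ← hS'₁, assoc, S'.inl_fst, comp_id, sub_self])
  let φ : Q ⟶ Y := (S'.fst - S'.snd ≫ d) ≫ S.inl + S'.snd ≫ S.inr
  let ψ : Y ⟶ Q := S.fst ≫ S'.inl + S.snd ≫ (S'.inr + d ≫ S'.inl)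
  have hφψ : φ ≫ ψ = 𝟙 Q := by
    apply S'.hom_ext <;> apply S'.hom_ext' <;> simp [φ, ψ]
  have hψφ : ψ ≫ φ = 𝟙 Y := by
    apply S.hom_ext <;> apply S.hom_ext' <;> simp [φ, ψ]
  let e : Q ≅ Y := ⟨φ, ψ, hφψ, hψφ⟩
  have hvφ : v ≫ φ = f := by
    have h3 := O.comm₃
    rw [← hS'₂] at h3
    apply S.hom_ext
    · simp only [φ, Preadditive.comp_add, Preadditive.add_comp, assoc, S.inl_fst, S.inr_fst,
        comp_id, comp_zero, add_zero, Preadditive.comp_sub, reassoc_of% h3]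
      rw [sub_eq_iff_eq_add] at hd ⊢
      rw [hd, add_comm, assoc]
    · simp [φ, h3]
  refine ⟨ψ ≫ w, h₃.of_iso (Iso.refl _) (Iso.refl _) e.symm ?_ ?_ ?_, ?_, ?_⟩
  · simp
  · have : f ≫ ψ = v := by rw [← hvφ, assoc, hφψ, comp_id]
    simpa [e] using this
  · simp [e]
  · have : S.inl ≫ ψ = O.m₁ := by simp [ψ, ← hS'₁]
    rw [← assoc, this, O.comm₂]
  · have : ψ ≫ O.m₃ = S.snd := by rw [← hS'₂]; simp [ψ]
    rw [assoc, O.comm₄, ← assoc, this]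

end

/-! ### Exactness of a functor at a single morphism. -/

section Exactness

variable {C : Type u} [Category.{v} C] [Preadditive C] [HasZeroObject C] [HasShift C ℤ]
  [∀ n : ℤ, (shiftFunctor C n).Additive] [Pretriangulated C]
  {D : Type u'} [Category.{v'} D] [Preadditive D] [HasZeroObject D] [HasShift D ℤ]
  [∀ n : ℤ, (shiftFunctor D n).Additive] [Pretriangulated D]
  (F : C ⥤ D) [F.CommShift ℤ]

/-- The image under `F` of the triangle `(f, g, h)` is distinguished. -/
abbrev MapDist {X Y Z : C} (f : X ⟶ Y) (g : Y ⟶ Z) (h : Z ⟶ X⟦(1 : ℤ)⟧) : Prop :=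
  Dist (F.map f) (F.map g) (F.map h ≫ (F.commShiftIso (1 : ℤ)).hom.app X)

/-- The functor `F` is exact at the morphism `g`: the image of every distinguished triangle
extending `g` is distinguished. -/
def ExactAt {Y Z : C} (g : Y ⟶ Z) : Prop :=
  ∀ ⦃X : C⦄ (f : X ⟶ Y) (h : Z ⟶ X⟦(1 : ℤ)⟧), Dist f g h → MapDist F f g h

variable {F}

section

variable {X Y Z X' Y' Z' : C} {f : X ⟶ Y} {g : Y ⟶ Z} {h : Z ⟶ X⟦(1 : ℤ)⟧}
  {f' : X' ⟶ Y'} {g' : Y' ⟶ Z'} {h' : Z' ⟶ X'⟦(1 : ℤ)⟧}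

lemma MapDist.of_iso (H : MapDist F f g h) (e₁ : X' ≅ X) (e₂ : Y' ≅ Y) (e₃ : Z' ≅ Z)
    (c₁ : f' ≫ e₂.hom = e₁.hom ≫ f) (c₂ : g' ≫ e₃.hom = e₂.hom ≫ g)
    (c₃ : h' ≫ e₁.hom⟦(1 : ℤ)⟧' = e₃.hom ≫ h) : MapDist F f' g' h' := by
  refine Dist.of_iso H (F.mapIso e₁) (F.mapIso e₂) (F.mapIso e₃) ?_ ?_ ?_
  · rw [F.mapIso_hom, F.mapIso_hom, ← F.map_comp, c₁, F.map_comp]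
  · rw [F.mapIso_hom, F.mapIso_hom, ← F.map_comp, c₂, F.map_comp]
  · have := F.commShiftIso_hom_naturality e₁.hom (1 : ℤ)
    rw [assoc, F.mapIso_hom, ← this, ← F.map_comp_assoc, c₃, F.map_comp, assoc]
    rfl

lemma mapDist_rot_iff [F.Additive] : MapDist F g h (-f⟦(1 : ℤ)⟧') ↔ MapDist F f g h := by
  have key := F.commShiftIso_hom_naturality f (1 : ℤ)
  constructor
  · intro H
    refine Dist.of_rot (Dist.of_iso H (Iso.refl _) (Iso.refl _)
      ((F.commShiftIso (1 : ℤ)).symm.app X) ?_ ?_ ?_)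
    · simp
    · simp
    · simp [key]
  · intro H
    refine Dist.of_iso (Dist.rot H) (Iso.refl _) (Iso.refl _)
      ((F.commShiftIso (1 : ℤ)).app X) ?_ ?_ ?_
    · simp
    · simp
    · simp [key]

/-- All triangles on a given morphism are isomorphic, so testing one of them suffices. -/
lemma ExactAt.of_dist₂ (H : Dist f g h) (HF : MapDist F f g h) : ExactAt F g := by
  intro X' f' h' H'
  obtain ⟨e, he₁, he₂⟩ := H'.rot.exists_iso₃ H.rot
  obtain ⟨k, hk⟩ := (shiftFunctor C (1 : ℤ)).map_surjective e.hom
  have : IsIso k := by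
    have : IsIso (k⟦(1 : ℤ)⟧') := by rw [hk]; infer_instance
    exact isIso_of_reflects_iso k (shiftFunctor C (1 : ℤ))
  refine HF.of_iso (asIso k) (Iso.refl _) (Iso.refl _) ?_ (by simp) ?_
  · apply (shiftFunctor C (1 : ℤ)).map_injective
    simpa [hk] using he₂.symm
  · simpa [hk] using he₁

variable [F.Additive]

lemma ExactAt.of_dist₃ (H : Dist f g h) (HF : MapDist F f g h) : ExactAt F h :=
  ExactAt.of_dist₂ H.rot (mapDist_rot_iff.2 HF)

lemma MapDist.congr (HF : MapDist F f g h) (H : Dist f g h) {Z' : C} {g' : Y ⟶ Z'}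
    {h' : Z' ⟶ X⟦(1 : ℤ)⟧} (H' : Dist f g' h') : MapDist F f g' h' := by
  obtain ⟨e, he₁, he₂⟩ := H'.exists_iso₃ H
  exact HF.of_iso (Iso.refl _) (Iso.refl _) e (by simp) (by simpa using he₁)
    (by simpa using he₂.symm)

lemma ExactAt.of_dist₁ (H : Dist f g h) (HF : MapDist F f g h) : ExactAt F f := by
  obtain ⟨W, k, l, H'⟩ := exists_dist₁₃ f
  exact .of_dist₂ H' (mapDist_rot_iff.1 (HF.congr H H'.rot))

lemma ExactAt.mapDist₁ (hf : ExactAt F f) (H : Dist f g h) : MapDist F f g h := by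
  obtain ⟨W, k, l, H'⟩ := exists_dist₁₃ f
  exact (mapDist_rot_iff.2 (hf _ _ H')).congr H'.rot H

lemma ExactAt.mapDist₃ (hh : ExactAt F h) (H : Dist f g h) : MapDist F f g h :=
  mapDist_rot_iff.1 (hh _ _ H.rot)

lemma ExactAt.of_iso (hg : ExactAt F g) (e₂ : Y' ≅ Y) (e₃ : Z' ≅ Z)
    (c : g' ≫ e₃.hom = e₂.hom ≫ g) : ExactAt F g' := by
  intro W f' h' H
  have H' : Dist (f' ≫ e₂.hom) g (e₃.inv ≫ h') := by
    refine H.of_iso (Iso.refl _) e₂.symm e₃.symm (by simp) ?_ (by simp)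
    rw [Iso.symm_hom, Iso.comp_inv_eq, assoc, Iso.symm_hom, c, Iso.inv_hom_id_assoc]
  exact (hg _ _ H').of_iso (Iso.refl _) e₂ e₃ (by simp) c (by simp)

/-- A zero morphism is the connecting morphism of the split triangle on `Z⟦-1⟧ ⊞ Y`, and additive
functors preserve splittings. -/
lemma ExactAt.zero (Y Z : C) : ExactAt F (0 : Y ⟶ Z) := by
  let S : Splitting (Z⟦(-1 : ℤ)⟧ ⊞ Y) (Z⟦(-1 : ℤ)⟧) Y :=
    ⟨biprod.inl, biprod.inr, biprod.fst, biprod.snd, by simp, by simp, by simp, by simp, by simp⟩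
  have H : ExactAt F (0 : Y ⟶ Z⟦(-1 : ℤ)⟧⟦(1 : ℤ)⟧) :=
    .of_dist₃ S.dist (by simpa [MapDist] using (S.map F).dist)
  exact H.of_iso (Iso.refl _) (shiftNegShift Z (1 : ℤ)).symm
    (by rw [zero_comp, comp_zero])

/-- Three rotations shift a triangle up to signs, and a sign does not affect exactness at a
morphism. -/
lemma exactAt_shift_iff : ExactAt F (g⟦(1 : ℤ)⟧') ↔ ExactAt F g := by
  have neg : ∀ {A B : C} (k : A ⟶ B), ExactAt F k → ExactAt F (-k) := fun k hk =>
    hk.of_iso (Iso.refl _) ⟨-𝟙 _, -𝟙 _, by simp, by simp⟩ (by simp)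
  constructor
  · intro hg X f h H
    exact mapDist_rot_iff.1 (mapDist_rot_iff.1 (mapDist_rot_iff.1 (neg _ hg _ _ H.rot.rot.rot)))
  · intro hg
    obtain ⟨X, f, h, H⟩ := exists_dist₁₃ g
    have := neg _ (ExactAt.of_dist₂ H.rot.rot.rot
      (mapDist_rot_iff.2 (mapDist_rot_iff.2 (mapDist_rot_iff.2 (hg _ _ H)))))
    simpa using this

end

section

variable [CategoryTheory.IsTriangulated C] [CategoryTheory.IsTriangulated D] [F.Additive] [F.Full]
  [F.Faithful]

/-- A criterion for exactness at a morphism to a direct sum. -/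
lemma Splitting.exactAt {X Y Y₁ Y₂ A Z : C} (S : Splitting Y Y₁ Y₂) (f : X ⟶ Y)
    {a : A ⟶ X} {b : Y₂ ⟶ A⟦(1 : ℤ)⟧} (h₁ : Dist a (f ≫ S.snd) b)
    (m₁ : MapDist F a (f ≫ S.snd) b)
    {z : Z ⟶ A} {c : Y₁ ⟶ Z⟦(1 : ℤ)⟧} (h₂ : Dist z (a ≫ f ≫ S.fst) c)
    (m₂ : MapDist F z (a ≫ f ≫ S.fst) c)
    (hν : ∀ ν : Y₂ ⟶ Y₁, f ≫ S.snd ≫ ν ≫ c = 0 → ∃ κ : A⟦(1 : ℤ)⟧ ⟶ Y₁, ν ≫ c = b ≫ κ ≫ c) :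
    ExactAt F f := by
  obtain ⟨h, H, hh₁, hh₂⟩ := S.exists_dist f h₁ h₂
  rw [MapDist, F.map_comp] at m₁
  rw [MapDist, F.map_comp, F.map_comp] at m₂
  obtain ⟨h', H', hh'₁, hh'₂⟩ := (S.map F).exists_dist (F.map f) m₁ m₂
  -- The two-step fibre is formed in both categories. Fullness lifts the connecting morphism found
  -- in `D` to some `k`, which need not equal `h`.
  obtain ⟨k, hk⟩ := F.map_surjective (h' ≫ (F.commShiftIso (1 : ℤ)).inv.app Z)
  replace hk : F.map k ≫ (F.commShiftIso (1 : ℤ)).hom.app Z = h' := by simp [hk]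
  rw [← hk] at H' hh'₁ hh'₂
  have M : MapDist F (z ≫ a) f k := by rw [MapDist, F.map_comp]; exact H'
  have hk₁ : S.inl ≫ k = c := by
    apply F.map_injective
    rw [← cancel_mono ((F.commShiftIso (1 : ℤ)).hom.app Z), F.map_comp, assoc]
    exact hh'₁
  have hk₂ : k ≫ z⟦(1 : ℤ)⟧' = S.snd ≫ b := by
    apply F.map_injective
    rw [← cancel_mono ((F.commShiftIso (1 : ℤ)).hom.app A), F.map_comp, F.map_comp, assoc, assoc,
      F.commShiftIso_hom_naturality, ← assoc]
    exact hh'₂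
  have hk₃ : f ≫ k = 0 := by
    apply F.map_injective
    rw [← cancel_mono ((F.commShiftIso (1 : ℤ)).hom.app Z), F.map_comp, assoc, F.map_zero,
      zero_comp]
    exact Dist.comp₂₃ M
  -- Since `k` and `h` agree on `Y₁` and after composition with `z⟦1⟧'`, their difference is
  -- governed by a single morphism `ν : Y₂ ⟶ Y₁`.
  obtain ⟨ν, hν'⟩ := h₂.lift₁ (S.inr ≫ (k - h)) (by
    rw [assoc, Preadditive.sub_comp, hk₂, hh₂, sub_self, comp_zero])
  have hsub : k - h = S.snd ≫ ν ≫ c := by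
    rw [← hν']
    apply S.hom_ext'
    · simp [hk₁, hh₁]
    · simp
  obtain ⟨κ, hκ⟩ := hν ν (by rw [← hsub, Preadditive.comp_sub, hk₃, H.comp₂₃, sub_self])
  have hcz : c ≫ z⟦(1 : ℤ)⟧' = 0 := h₂.comp₃₁
  -- As `θ` has square zero and `θ ≫ z = 0`, the automorphism `𝟙 Z + θ` preserves `z ≫ a`; its shift
  -- carries `h` to `k`. Hence the triangle with `k` is itself distinguished.
  obtain ⟨θ, hθ⟩ := (shiftFunctor C (1 : ℤ)).map_surjective (z⟦(1 : ℤ)⟧' ≫ κ ≫ c)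
  have hθz : θ ≫ z = 0 := by
    apply (shiftFunctor C (1 : ℤ)).map_injective
    simp [hθ, hcz]
  have hθθ : θ ≫ θ = 0 := by
    apply (shiftFunctor C (1 : ℤ)).map_injective
    rw [Functor.map_comp]
    nth_rw 2 [hθ]
    rw [← Functor.map_comp_assoc, hθz]
    simp
  have hhθ : h ≫ θ⟦(1 : ℤ)⟧' = k - h := by
    rw [hθ, reassoc_of% hh₂, ← hκ, hsub]
  refine .of_dist₂ (H.of_iso (f' := z ≫ a) (h' := k) ⟨𝟙 Z - θ, 𝟙 Z + θ, ?_, ?_⟩ (Iso.refl _)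
    (Iso.refl _) ?_ (by simp) ?_) M
  · simp [hθθ]
  · simp [hθθ]
  · simp [reassoc_of% hθz]
  · have : k = h + (k - h) := by abel
    have h0 : θ⟦(1 : ℤ)⟧' ≫ θ⟦(1 : ℤ)⟧' = 0 := by
      rw [← Functor.map_comp, hθθ, Functor.map_zero]
    rw [this, ← hhθ]
    simp [h0]

lemma Splitting.exactAt_of_hom_zero {X Y Y₁ Y₂ A : C} (S : Splitting Y Y₁ Y₂) (f : X ⟶ Y)
    {a : A ⟶ X} {b : Y₂ ⟶ A⟦(1 : ℤ)⟧} (h₁ : Dist a (f ≫ S.snd) b)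
    (m₁ : ExactAt F (f ≫ S.snd)) (m₂ : ExactAt F (a ≫ f ≫ S.fst))
    (h : ∀ ν : Y₂ ⟶ Y₁, ν = 0) : ExactAt F f := by
  obtain ⟨Z, z, c, h₂⟩ := exists_dist₁₃ (a ≫ f ≫ S.fst)
  exact S.exactAt f h₁ (m₁ _ _ h₁) h₂ (m₂ _ _ h₂) (fun ν _ => ⟨0, by simp [h ν]⟩)

/-- Summands of the target not met by `f` can be discarded. The morphism `A ⟶ Y₁` is zero, so `c` is
a monomorphism; the condition on `ν` then forces `f ≫ S.snd ≫ ν = 0`, and `ν` factors through `b`.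
-/
lemma Splitting.exactAt_of_comp_fst {X Y Y₁ Y₂ : C} (S : Splitting Y Y₁ Y₂) (f : X ⟶ Y)
    (hf : f ≫ S.fst = 0) (m : ExactAt F (f ≫ S.snd)) : ExactAt F f := by
  obtain ⟨A, a, b, h₁⟩ := exists_dist₁₃ (f ≫ S.snd)
  obtain ⟨Z, z, c, h₂⟩ := exists_dist₁₃ (a ≫ f ≫ S.fst)
  refine S.exactAt f h₁ (m _ _ h₁) h₂ ?_ ?_
  · have : ExactAt F (a ≫ f ≫ S.fst) := by rw [hf, comp_zero]; exact .zero _ _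
    exact this _ _ h₂
  · intro ν hν
    have h0 : f ≫ S.snd ≫ ν = 0 := by
      obtain ⟨ψ, hψ⟩ := h₂.lift₃ (f ≫ S.snd ≫ ν) (by simpa using hν)
      rw [hψ, hf, comp_zero, comp_zero]
    obtain ⟨κ, hκ⟩ := h₁.desc₃ ν (by simpa using h0)
    exact ⟨κ, by rw [hκ, assoc]⟩

end
end Exactness

/-! ### t-structures whose truncation triangles split. -/

section TStructureLemmas

variable {C : Type u} [Category.{v} C] [Preadditive C] [HasZeroObject C] [HasShift C ℤ]
  [∀ n : ℤ, (shiftFunctor C n).Additive] [Pretriangulated C]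

lemma Dist.exists_iso₁ {X X' Y Z : C} {f : X ⟶ Y} {g : Y ⟶ Z} {h : Z ⟶ X⟦(1 : ℤ)⟧}
    (H : Dist f g h) {f' : X' ⟶ Y} {h' : Z ⟶ X'⟦(1 : ℤ)⟧} (H' : Dist f' g h') :
    Nonempty (X ≅ X') := by
  obtain ⟨e, -, -⟩ := H.rot.exists_iso₃ H'.rot
  exact ⟨(shiftFunctor C (1 : ℤ)).preimageIso e⟩

variable (t : TStructure C)

lemma Dist.isLE₂ {X Y Z : C} {f : X ⟶ Y} {g : Y ⟶ Z} {h : Z ⟶ X⟦(1 : ℤ)⟧} (H : Dist f g h)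
    (n : ℤ) (h₁ : t.IsLE X n) (h₃ : t.IsLE Z n) : t.IsLE Y n :=
  t.isLE₂ _ H n h₁ h₃

lemma Dist.isGE₂ {X Y Z : C} {f : X ⟶ Y} {g : Y ⟶ Z} {h : Z ⟶ X⟦(1 : ℤ)⟧} (H : Dist f g h)
    (n : ℤ) (h₁ : t.IsGE X n) (h₃ : t.IsGE Z n) : t.IsGE Y n :=
  t.isGE₂ _ H n h₁ h₃

variable {t}

lemma isLE_of_retract {X Y : C} (i : X ⟶ Y) (r : Y ⟶ X) (h : i ≫ r = 𝟙 X) (n : ℤ)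
    (hY : t.IsLE Y n) : t.IsLE X n := by
  rw [t.isLE_iff_orthogonal n (n + 1) rfl]
  intro Z f hZ
  rw [← id_comp f, ← h, assoc, t.zero (r ≫ f) n (n + 1), comp_zero]

lemma isGE_of_retract {X Y : C} (i : X ⟶ Y) (r : Y ⟶ X) (h : i ≫ r = 𝟙 X) (n : ℤ)
    (hY : t.IsGE Y n) : t.IsGE X n := by
  rw [t.isGE_iff_orthogonal (n - 1) n (by lia)]
  intro Z f hZ
  rw [← comp_id f, ← h, ← assoc, t.zero (f ≫ i) (n - 1) n, zero_comp]

variable (t) in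
/-- There are no nonzero morphisms from objects `≥ n` to objects `≤ m` if `m + 2 ≤ n`. -/
def HomGap : Prop :=
  ∀ ⦃X Y : C⦄ (f : X ⟶ Y) (n m : ℤ), t.IsGE X n → t.IsLE Y m → m + 2 ≤ n → f = 0

/-- The connecting morphism of the truncation triangle goes from degrees `≥ n + 1` to degrees `≤ n -
1`, which is exactly the gap. -/
lemma HomGap.exists_splitting (ht : HomGap t) (X : C) (n : ℤ) :
    ∃ (X₁ X₂ : C) (_ : Splitting X X₁ X₂), t.IsLE X₁ n ∧ t.IsGE X₂ (n + 1) := by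
  obtain ⟨X₁, X₂, h₁, h₂, f, g, h, H⟩ := t.exists_triangle X n (n + 1) rfl
  have hX₁ : t.IsLE X₁ n := ⟨h₁⟩
  have := t.isLE_shift X₁ n 1 (n - 1)
  obtain rfl : h = 0 := ht h (n + 1) (n - 1) ⟨h₂⟩ inferInstance (by lia)
  obtain ⟨S, -, -⟩ := Dist.exists_splitting H
  exact ⟨X₁, X₂, S, hX₁, ⟨h₂⟩⟩

end TStructureLemmas

/-! ### From exactness on the heart to exactness everywhere. -/

section Exactness

variable {C : Type u} [Category.{v} C] [Preadditive C] [HasZeroObject C] [HasShift C ℤ]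
  [∀ n : ℤ, (shiftFunctor C n).Additive] [Pretriangulated C] [CategoryTheory.IsTriangulated C]
  {D : Type u'} [Category.{v'} D] [Preadditive D] [HasZeroObject D] [HasShift D ℤ]
  [∀ n : ℤ, (shiftFunctor D n).Additive] [Pretriangulated D] [CategoryTheory.IsTriangulated D]
  {F : C ⥤ D} [F.CommShift ℤ] [F.Additive] [F.Full] [F.Faithful] {t : TStructure C}

variable (F t) in
/-- `F` maps distinguished triangles in the heart to distinguished triangles. -/
def ExactOnHeart : Prop :=
  ∀ ⦃X Y Z : C⦄ (f : X ⟶ Y) (g : Y ⟶ Z) (h : Z ⟶ X⟦(1 : ℤ)⟧), Dist f g h →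
    t.heart X → t.heart Y → t.heart Z → MapDist F f g h

namespace ExactOnHeart

/-- Here `e` is an extension class: `K⟦-1⟧` and `Y` lie in the heart, hence so does the middle term
`A`, and exactness on the heart applies. -/
lemma exists_fibre (hF : ExactOnHeart F t) {Y K : C} (e : Y ⟶ K) (hY : t.heart Y)
    (hK : t.IsLE K (-1)) (hK' : t.IsGE K (-1)) :
    ∃ (A : C) (a : A ⟶ Y) (b : K ⟶ A⟦(1 : ℤ)⟧),
      Dist a e b ∧ t.heart A ∧ ExactAt F e := by
  let i : K⟦(-1 : ℤ)⟧⟦(1 : ℤ)⟧ ≅ K := shiftNegShift K (1 : ℤ)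
  obtain ⟨A, f, g, H⟩ := exists_dist₁₂ (e ≫ i.inv)
  have := t.isLE_shift K (-1) (-1) 0
  have := t.isGE_shift K (-1) (-1) 0
  rw [t.mem_heart_iff] at hY
  have hA : t.heart A := by
    rw [t.mem_heart_iff]
    exact ⟨H.isLE₂ t 0 inferInstance hY.1, H.isGE₂ t 0 inferInstance hY.2⟩
  have hM := hF _ _ _ H (by rw [t.mem_heart_iff]; constructor <;> infer_instance) hA
    (by rwa [t.mem_heart_iff])
  have H' : Dist g e (i.inv ≫ (-f⟦(1 : ℤ)⟧')) :=
    H.rot.of_iso (Iso.refl _) (Iso.refl _) i.symm (by simp) (by simp) (by simp)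
  exact ⟨A, g, _, H', hA, (ExactAt.of_dist₃ H hM).of_iso (Iso.refl _) i.symm (by simp)⟩

/-- The cone of `f` splits as `K ⊕ Q`, the shifted kernel and the cokernel. The fibre `A` of `Y ⟶ K`
lies in the heart, and the fibre of `A ⟶ Q` is again `X`, so the cone is reached through two
triangles in the heart. -/
lemma exactAt_heart (hF : ExactOnHeart F t) (ht : HomGap t) {X Y : C} (f : X ⟶ Y)
    (hX : t.heart X) (hY : t.heart Y) : ExactAt F f := by
  obtain ⟨Z, g, h, H⟩ := exists_dist₂₃ f
  have hX' := (t.mem_heart_iff _).1 hX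
  have hY' := (t.mem_heart_iff _).1 hY
  have hX₁ := hX'.1
  have hX₂ := hX'.2
  have : t.IsLE (X⟦(1 : ℤ)⟧) (-1) := t.isLE_shift X 0 1 (-1)
  have : t.IsGE (X⟦(1 : ℤ)⟧) (-1) := t.isGE_shift X 0 1 (-1)
  have hZ : t.IsLE Z 0 := H.rot.isLE₂ t 0 hY'.1 (t.isLE_of_le _ (-1) 0)
  have hZ' : t.IsGE Z (-1) := by
    have := hY'.2
    exact H.rot.isGE₂ t (-1) (t.isGE_of_ge _ (-1) 0) inferInstance
  obtain ⟨K, Q, S, hK, hQ⟩ := ht.exists_splitting Z (-1)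
  have hK' : t.IsGE K (-1) := isGE_of_retract _ _ S.inl_fst _ hZ'
  have hQ' : t.heart Q := by
    rw [t.mem_heart_iff]
    exact ⟨isLE_of_retract _ _ S.inr_snd _ hZ, hQ⟩
  obtain ⟨A, a, b, hA, hA', e⟩ := hF.exists_fibre (g ≫ S.fst) hY hK hK'
  refine .of_dist₁ H (ExactAt.mapDist₁ ?_ H.rot |> mapDist_rot_iff.1)
  refine S.symm.exactAt_of_hom_zero g hA e ?_ ?_
  · obtain ⟨X', z, c, hz⟩ := exists_dist₁₃ (a ≫ g ≫ S.symm.fst)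
    obtain ⟨h', hz', -⟩ := S.symm.exists_dist g hA hz
    obtain ⟨i⟩ := H.exists_iso₁ hz'
    exact .of_dist₂ hz (hF _ _ _ hz (t.heart.prop_of_iso i hX) hA' hQ')
  · intro ν
    exact t.zero ν (-1) (-1 + 1)

/-- Only the summands of `Y` in degrees `-1` and `0` receive morphisms from the heart. The degree
`-1` part is an extension class with fibre in the heart, leaving a morphism between heart objects.
-/
lemma exactAt_of_heart (hF : ExactOnHeart F t) (ht : HomGap t) {X Y : C} (f : X ⟶ Y)
    (hX : t.heart X) : ExactAt F f := by
  have hX' := (t.mem_heart_iff _).1 hX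
  have hX₁ := hX'.1
  have hX₂ := hX'.2
  obtain ⟨P, Q, S, hP, hQ⟩ := ht.exists_splitting Y 0
  refine S.symm.exactAt_of_comp_fst f (t.zero _ 0 (0 + 1)) ?_
  generalize f ≫ S.symm.snd = g
  clear S
  obtain ⟨R, K, S, hR, hK⟩ := ht.exists_splitting P (-2)
  refine S.exactAt_of_comp_fst g (ht _ _ _ hX₂ hR (by lia)) ?_
  generalize g ≫ S.snd = g
  replace hK : t.IsGE K (-1) := hK
  have hK' : t.IsLE K 0 := isLE_of_retract _ _ S.inr_snd _ hP
  clear S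
  obtain ⟨K₁, K₀, S, hK₁, hK₀⟩ := ht.exists_splitting K (-1)
  have hK₁' : t.IsGE K₁ (-1) := isGE_of_retract _ _ S.inl_fst _ hK
  have hK₀' : t.heart K₀ := by
    rw [t.mem_heart_iff]
    exact ⟨isLE_of_retract _ _ S.inr_snd _ hK', hK₀⟩
  obtain ⟨A, a, b, hA, hA', e⟩ := hF.exists_fibre (g ≫ S.fst) hX hK₁ hK₁'
  refine S.symm.exactAt_of_hom_zero g hA e (hF.exactAt_heart ht _ hA' hK₀') ?_
  intro ν
  exact t.zero ν (-1) (-1 + 1)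

end ExactOnHeart

variable (F) in
/-- `F` is exact at all the morphisms with target `X`. -/
def ExactTo (X : C) : Prop :=
  ∀ ⦃W : C⦄ (g : W ⟶ X), ExactAt F g

namespace ExactTo

lemma of_iso {X Y : C} (hX : ExactTo F X) (e : X ≅ Y) : ExactTo F Y :=
  fun _ g => (hX (g ≫ e.inv)).of_iso (Iso.refl _) e.symm (by simp)

lemma shift_one_iff (X : C) : ExactTo F (X⟦(1 : ℤ)⟧) ↔ ExactTo F X := by
  constructor
  · intro hX W g
    rw [← exactAt_shift_iff]
    exact hX _
  · intro hX W g
    let i : W⟦(-1 : ℤ)⟧⟦(1 : ℤ)⟧ ≅ W := shiftNegShift W (1 : ℤ)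
    obtain ⟨k, hk⟩ := (shiftFunctor C (1 : ℤ)).map_surjective (i.hom ≫ g)
    exact (exactAt_shift_iff.2 (hX k)).of_iso i.symm (Iso.refl _) (by simp [hk])

lemma shift_iff (X : C) (n : ℤ) : ExactTo F (X⟦n⟧) ↔ ExactTo F X := by
  have key (m : ℤ) : ExactTo F (X⟦m + 1⟧) ↔ ExactTo F (X⟦m⟧) := by
    rw [← shift_one_iff (X⟦m⟧)]
    let i := (shiftFunctorAdd C m 1).app X
    exact ⟨fun h => h.of_iso i, fun h => h.of_iso i.symm⟩
  induction n using Int.induction_on with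
  | zero =>
    let i := (shiftFunctorZero C ℤ).app X
    exact ⟨fun h => h.of_iso i, fun h => h.of_iso i.symm⟩
  | succ n hn => exact (key n).trans hn
  | pred n hn =>
    have h := key (-n - 1)
    rw [sub_add_cancel] at h
    exact h.symm.trans hn

lemma of_splitting {X X₁ X₂ : C} (S : Splitting X X₁ X₂) (h₁ : ExactTo F X₁)
    (h₂ : ExactTo F X₂) (h : ∀ ν : X₂ ⟶ X₁, ν = 0) : ExactTo F X := by
  intro W g
  obtain ⟨A, a, b, hA⟩ := exists_dist₁₃ (g ≫ S.snd)
  exact S.exactAt_of_hom_zero g hA (h₂ _) (h₁ _) h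

end ExactTo

namespace ExactOnHeart

/-- Rotation trades `g`, with target `X`, for the connecting morphism `b`, with source `X`. -/
lemma exactTo_of_heart (hF : ExactOnHeart F t) (ht : HomGap t) {X : C} (hX : t.heart X) :
    ExactTo F X := by
  intro W g
  obtain ⟨A, a, b, hA⟩ := exists_dist₁₃ g
  exact .of_dist₂ hA ((hF.exactAt_of_heart ht b hX).mapDist₃ hA)

/-- Induction on the amplitude: the top degree splits off, and nothing maps from the lower part to
it. -/
lemma exactTo (hF : ExactOnHeart F t) (ht : HomGap t) (k : ℕ) :
    ∀ (X : C) (n : ℤ), t.IsGE X n → t.IsLE X (n + k) → ExactTo F X := by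
  induction k with
  | zero =>
    intro X n h₁ h₂
    rw [← ExactTo.shift_iff X n]
    refine hF.exactTo_of_heart ht ?_
    rw [t.mem_heart_iff]
    exact ⟨t.isLE_shift X (n + (0 : ℕ)) n 0 (by simp), t.isGE_shift X n n 0⟩
  | succ k hk =>
    intro X n h₁ h₂
    obtain ⟨X₁, X₂, S, h₁', h₂'⟩ := ht.exists_splitting X (n + k)
    refine .of_splitting S.symm ?_ (hk X₁ n (isGE_of_retract _ _ S.inl_fst _ h₁) h₁')
      (fun ν => t.zero ν (n + k) (n + k + 1))
    rw [← ExactTo.shift_iff X₂ (n + k + 1)]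
    refine hF.exactTo_of_heart ht ?_
    have : t.IsLE X₂ (n + k + 1) := isLE_of_retract _ _ S.inr_snd _ (by
      rw [add_assoc]; exact_mod_cast h₂)
    rw [t.mem_heart_iff]
    exact ⟨t.isLE_shift X₂ (n + k + 1) _ 0, t.isGE_shift X₂ (n + k + 1) _ 0⟩

/-- A fully faithful functor which is exact on the heart of a bounded t-structure of
global dimension at most one is a triangle functor. -/
theorem isTriangulated (hF : ExactOnHeart F t) (ht : HomGap t) (hb : IsBounded t) :
    F.IsTriangulated where
  map_distinguished T hT := by
    obtain ⟨n, h₁, h₂⟩ := hb T.obj₃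
    have : ExactAt F T.mor₂ :=
      hF.exactTo ht (2 * n) T.obj₃ (-n) ⟨h₁⟩ ⟨by convert h₂ using 1; push_cast; ring⟩ _
    exact this _ _ hT

end ExactOnHeart

end Exactness

/-! ### Finite direct sum decompositions. -/

section Decomp

variable {C : Type u} [Category.{v} C] [Preadditive C]

/-- The data exhibiting `X` as the direct sum of a finite family of objects. -/
structure Decomp (X : C) {J : Type} [Fintype J] (Y : J → C) where
  /-- the inclusions of the summands -/
  ι (a : J) : Y a ⟶ X
  /-- the projections to the summands -/
  π (a : J) : X ⟶ Y a
  ι_π_self (a : J) : ι a ≫ π a = 𝟙 (Y a)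
  ι_π_ne (a b : J) (h : a ≠ b) : ι a ≫ π b = 0
  total : ∑ a, π a ≫ ι a = 𝟙 X

namespace Decomp

attribute [simp] ι_π_self

variable {X : C} {J : Type} [Fintype J] {Y : J → C} (d : Decomp X Y)

lemma hom_ext {W : C} {f g : W ⟶ X} (h : ∀ a, f ≫ d.π a = g ≫ d.π a) : f = g := by
  rw [← comp_id f, ← comp_id g, ← d.total, Preadditive.comp_sum, Preadditive.comp_sum]
  exact Finset.sum_congr rfl (fun a _ => by rw [← assoc, h, assoc])

lemma hom_ext' {W : C} {f g : X ⟶ W} (h : ∀ a, d.ι a ≫ f = d.ι a ≫ g) : f = g := by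
  rw [← id_comp f, ← id_comp g, ← d.total, Preadditive.sum_comp, Preadditive.sum_comp]
  exact Finset.sum_congr rfl (fun a _ => by rw [assoc, h, assoc])

/-- The image of a direct sum decomposition under an additive functor. -/
def map {D : Type u'} [Category.{v'} D] [Preadditive D] (F : C ⥤ D) [F.Additive] :
    Decomp (F.obj X) (fun a => F.obj (Y a)) where
  ι a := F.map (d.ι a)
  π a := F.map (d.π a)
  ι_π_self a := by rw [← F.map_comp, d.ι_π_self, F.map_id]
  ι_π_ne a b h := by rw [← F.map_comp, d.ι_π_ne a b h, F.map_zero]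
  total := by
    rw [← F.map_id, ← d.total, F.map_sum]
    exact Finset.sum_congr rfl (fun a _ => by rw [F.map_comp])

/-- Replace the object and the summands by isomorphic ones. -/
def ofIso {X' : C} {Y' : J → C} (e : X' ≅ X) (i : ∀ a, Y' a ≅ Y a) : Decomp X' Y' where
  ι a := (i a).hom ≫ d.ι a ≫ e.inv
  π a := e.hom ≫ d.π a ≫ (i a).inv
  ι_π_self a := by
    simp only [assoc, e.inv_hom_id_assoc]
    rw [← assoc (d.ι a), d.ι_π_self, id_comp, Iso.hom_inv_id]
  ι_π_ne a b h := by
    simp only [assoc, e.inv_hom_id_assoc]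
    rw [← assoc (d.ι a), d.ι_π_ne a b h, zero_comp, comp_zero]
  total := by
    simp only [assoc, Iso.inv_hom_id_assoc]
    simp only [← assoc (d.π _), ← Preadditive.comp_sum, ← Preadditive.sum_comp, d.total]
    simp

/-- Change the index set. -/
def reindex {J' : Type} [Fintype J'] (e : J' ≃ J) : Decomp X (fun a => Y (e a)) where
  ι a := d.ι (e a)
  π a := d.π (e a)
  ι_π_self a := d.ι_π_self _
  ι_π_ne a b h := d.ι_π_ne _ _ (fun h' => h (e.injective h'))
  total := by rw [← d.total]; exact e.sum_comp (fun a => d.π a ≫ d.ι a)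

/-- Combine decompositions of two summands. -/
def sum {X₁ X₂ : C} (S : Splitting X X₁ X₂) {J₁ J₂ : Type} [Fintype J₁] [Fintype J₂]
    (Y : J₁ ⊕ J₂ → C) (d₁ : Decomp X₁ (fun a => Y (.inl a)))
    (d₂ : Decomp X₂ (fun a => Y (.inr a))) : Decomp X Y where
  ι
    | .inl a => d₁.ι a ≫ S.inl
    | .inr a => d₂.ι a ≫ S.inr
  π
    | .inl a => S.fst ≫ d₁.π a
    | .inr a => S.snd ≫ d₂.π a
  ι_π_self := by rintro (a | a) <;> simp
  ι_π_ne := by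
    rintro (a | a) (b | b) h
    · simpa using d₁.ι_π_ne a b (by rintro rfl; exact h rfl)
    · simp
    · simp
    · simpa using d₂.ι_π_ne a b (by rintro rfl; exact h rfl)
  total := by
    rw [Fintype.sum_sum_type, ← S.total]
    congr 1
    · simp only [assoc]
      simp only [← assoc (d₁.π _), ← Preadditive.comp_sum, ← Preadditive.sum_comp, d₁.total,
        id_comp]
    · simp only [assoc]
      simp only [← assoc (d₂.π _), ← Preadditive.comp_sum, ← Preadditive.sum_comp, d₂.total,
        id_comp]

/-- The trivial decomposition with one summand. -/
def self (X : C) : Decomp X (fun _ : Unit => X) where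
  ι _ := 𝟙 X
  π _ := 𝟙 X
  ι_π_self _ := by simp
  ι_π_ne a b h := (h rfl).elim
  total := by simp

variable [HasFiniteBiproducts C]

/-- The canonical decomposition of a biproduct. -/
noncomputable def biproduct {J : Type} [Fintype J] (Y : J → C) : Decomp (⨁ Y) Y where
  ι a := biproduct.ι Y a
  π a := biproduct.π Y a
  ι_π_self a := by simp
  ι_π_ne a b h := biproduct.ι_π_ne Y h
  total := biproduct.total

/-- The isomorphism to the biproduct given by a decomposition. -/
noncomputable def iso : X ≅ ⨁ Y where
  hom := biproduct.lift d.π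
  inv := biproduct.desc d.ι
  hom_inv_id := by rw [biproduct.lift_desc, d.total]
  inv_hom_id := by
    classical
    ext b a
    by_cases h : a = b
    · subst h; simp
    · simp [d.ι_π_ne a b h, biproduct.ι_π_ne Y h]

/-- Separate the summands according to a predicate. -/
noncomputable def splitting (p : J → Prop) [DecidablePred p] :
    Splitting X (⨁ fun a : {a // p a} => Y a) (⨁ fun a : {a // ¬ p a} => Y a) where
  inl := biproduct.desc (fun a => d.ι a)
  inr := biproduct.desc (fun a => d.ι a)
  fst := biproduct.lift (fun a => d.π a)
  snd := biproduct.lift (fun a => d.π a)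
  inl_fst := by
    classical
    ext b a
    by_cases h : a = b
    · subst h; simp
    · simp [d.ι_π_ne a b (fun h' => h (Subtype.ext h')), biproduct.ι_π_ne _ h]
  inr_snd := by
    classical
    ext b a
    by_cases h : a = b
    · subst h; simp
    · simp [d.ι_π_ne a b (fun h' => h (Subtype.ext h')), biproduct.ι_π_ne _ h]
  inl_snd := by
    ext b a
    simp [d.ι_π_ne a b (fun h => b.2 (h ▸ a.2))]
  inr_fst := by
    ext b a
    simp [d.ι_π_ne a b (fun h => a.2 (h ▸ b.2))]
  total := by
    rw [biproduct.lift_desc, biproduct.lift_desc, ← d.total]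
    exact Fintype.sum_subtype_add_sum_subtype p (fun a => d.π a ≫ d.ι a)

end Decomp

end Decomp

/-! ### Generation by shifts of the heart. -/

section AddClosure

variable {C : Type u} [Category.{v} C] [Preadditive C] [HasZeroObject C] [HasShift C ℤ]
  [∀ n : ℤ, (shiftFunctor C n).Additive] [Pretriangulated C]

lemma addClosure_iff (P : ObjectProperty C) (X : C) :
    addClosure P X ↔ ∃ (J : Type) (_ : Fintype J) (Y : J → C) (_ : Decomp X Y), ∀ a, P (Y a) := by
  constructor
  · rintro ⟨k, Y, hY, ⟨e⟩⟩
    exact ⟨Fin k, inferInstance, Y, (Decomp.biproduct Y).ofIso e (fun _ => Iso.refl _), hY⟩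
  · rintro ⟨J, _, Y, d, hY⟩
    let e := (Fintype.equivFin J).symm
    exact ⟨_, fun a => Y (e a), fun a => hY _, ⟨(d.reindex e).iso⟩⟩

lemma addClosure_of_splitting (P : ObjectProperty C) {X X₁ X₂ : C} (S : Splitting X X₁ X₂)
    (h₁ : addClosure P X₁) (h₂ : addClosure P X₂) : addClosure P X := by
  rw [addClosure_iff] at h₁ h₂ ⊢
  obtain ⟨J₁, _, Y₁, d₁, hY₁⟩ := h₁
  obtain ⟨J₂, _, Y₂, d₂, hY₂⟩ := h₂
  exact ⟨J₁ ⊕ J₂, inferInstance, _, Decomp.sum S (Sum.elim Y₁ Y₂) d₁ d₂,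
    by rintro (a | a); exacts [hY₁ a, hY₂ a]⟩

lemma addClosure_of_prop (P : ObjectProperty C) {X : C} (h : P X) : addClosure P X := by
  rw [addClosure_iff]
  exact ⟨Unit, inferInstance, _, Decomp.self X, fun _ => h⟩

lemma addClosure_unionShifts_iff (H : ObjectProperty C) (X : C) :
    addClosure (unionShifts H) X ↔ ∃ (J : Type) (_ : Fintype J) (Z : J → C) (m : J → ℤ)
      (_ : Decomp X (fun a => (Z a)⟦m a⟧)), ∀ a, H (Z a) := by
  rw [addClosure_iff]
  constructor
  · rintro ⟨J, _, Y, d, hY⟩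
    choose m Z hZ e using hY
    exact ⟨J, inferInstance, Z, m, d.ofIso (Iso.refl _) (fun a => (e a).some.symm), hZ⟩
  · rintro ⟨J, _, Z, m, d, hZ⟩
    exact ⟨J, inferInstance, _, d, fun a => ⟨m a, Z a, hZ a, ⟨Iso.refl _⟩⟩⟩

lemma IsSplit.homGap {t : TStructure C} (ht : IsSplit t) : HomGap t := by
  intro X Y f n m hX hY hnm
  -- This shift puts the source in degrees `≥ 1` and the target in degrees `≤ m - n + 1 ≤ -1`, as
  -- the definition of a split t-structure requires.
  apply (shiftFunctor C (n - 1)).map_injective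
  obtain ⟨W, a, b, H⟩ := exists_dist₁₃ (f⟦n - 1⟧')
  have h₁ := t.isGE_shift X n (n - 1) 1
  have h₂ := t.isLE_shift Y m (n - 1) (m - n + 1)
  have h₃ := t.isLE_of_le (Y⟦n - 1⟧) (m - n + 1) (-1)
  rw [Functor.map_zero]
  exact ht _ _ _ H h₁.ge h₃.le

/-- A bounded t-structure for which all truncation triangles split generates the category from
the shifts of the heart. -/
lemma HomGap.addClosure_eq_top {t : TStructure C} (ht : HomGap t) (hb : IsBounded t) :
    addClosure (unionShifts t.heart) = ⊤ := by
  have base (X : C) (n : ℤ) (h₁ : t.IsGE X n) (h₂ : t.IsLE X n) :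
      addClosure (unionShifts t.heart) X := by
    refine addClosure_of_prop _ ⟨-n, X⟦n⟧, ?_, ⟨(shiftShiftNeg X n).symm⟩⟩
    rw [t.mem_heart_iff]
    exact ⟨t.isLE_shift X n n 0, t.isGE_shift X n n 0⟩
  have key (k : ℕ) : ∀ (X : C) (n : ℤ), t.IsGE X n → t.IsLE X (n + k) →
      addClosure (unionShifts t.heart) X := by
    induction k with
    | zero =>
      intro X n h₁ h₂
      exact base X n h₁ (by simpa using h₂)
    | succ k hk =>
      intro X n h₁ h₂
      obtain ⟨X₁, X₂, S, h₁', h₂'⟩ := ht.exists_splitting X (n + k)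
      refine addClosure_of_splitting _ S (hk X₁ n (isGE_of_retract _ _ S.inl_fst _ h₁) h₁')
        (base X₂ (n + k + 1) h₂' (isLE_of_retract _ _ S.inr_snd _ ?_))
      rw [add_assoc]; exact_mod_cast h₂
  ext X
  refine ⟨fun _ => trivial, fun _ => ?_⟩
  obtain ⟨n, h₁, h₂⟩ := hb X
  exact key (2 * n) X (-n) ⟨h₁⟩ ⟨by convert h₂ using 1; push_cast; ring⟩

end AddClosure

/-! ### The t-structure generated by a class without negative extensions. -/

section

variable {C : Type u} [Category.{v} C] [Preadditive C] [HasZeroObject C] [HasShift C ℤ]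
  [∀ n : ℤ, (shiftFunctor C n).Additive] [Pretriangulated C]

lemma Dist.desc₁ {X Y Z : C} {f : X ⟶ Y} {g : Y ⟶ Z} {h : Z ⟶ X⟦(1 : ℤ)⟧} (H : Dist f g h)
    {W : C} (φ : X ⟶ W) (hφ : h ≫ φ⟦(1 : ℤ)⟧' = 0) : ∃ ψ : Y ⟶ W, φ = f ≫ ψ := by
  obtain ⟨ψ, hψ⟩ := H.rot.rot.desc₂ (φ⟦(1 : ℤ)⟧') hφ
  obtain ⟨ψ', hψ'⟩ := (shiftFunctor C (1 : ℤ)).map_surjective (-ψ)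
  refine ⟨ψ', (shiftFunctor C (1 : ℤ)).map_injective ?_⟩
  rw [hψ, Functor.map_comp, hψ', Preadditive.neg_comp, Preadditive.comp_neg]

/-- Vanishing of morphisms out of a shift, reduced to the unshifted object. -/
lemma hom_eq_zero_of_shift_left {X Y : C} (a m m' : ℤ) (hm : m' + a = m)
    (h : ∀ g : X ⟶ Y⟦m'⟧, g = 0) (f : X⟦a⟧ ⟶ Y⟦m⟧) : f = 0 := by
  obtain ⟨g, hg⟩ := (shiftFunctor C a).map_surjective
    (f ≫ (shiftFunctorAdd' C m' a m hm).hom.app Y)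
  rw [h g, Functor.map_zero] at hg
  rw [← cancel_mono ((shiftFunctorAdd' C m' a m hm).hom.app Y), ← hg, zero_comp]

/-- Vanishing of morphisms to a shift, reduced to the unshifted object. -/
lemma hom_eq_zero_of_shift_right {X Y : C} (a m m' : ℤ) (hm : m' + a = m)
    (h : ∀ g : Y⟦m'⟧ ⟶ X, g = 0) (f : Y⟦m⟧ ⟶ X⟦a⟧) : f = 0 := by
  obtain ⟨g, hg⟩ := (shiftFunctor C a).map_surjective
    ((shiftFunctorAdd' C m' a m hm).inv.app Y ≫ f)
  rw [h g, Functor.map_zero] at hg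
  rw [← cancel_epi ((shiftFunctorAdd' C m' a m hm).inv.app Y), ← hg, comp_zero]

section

variable {H : ObjectProperty C} [H.IsClosedUnderFiniteProducts]

lemma Decomp.prop {X : C} {J : Type} [Fintype J] {Y : J → C} (d : Decomp X Y)
    (h : ∀ a, H (Y a)) : H X := by
  classical
  refine H.prop_of_isLimit_fan (F := Fan.mk X d.π)
    (Fan.IsLimit.mk _ (fun s => ∑ a, s.proj a ≫ d.ι a) (fun s b => ?_) (fun s m hm => ?_)) h
  · change (∑ a, s.proj a ≫ d.ι a) ≫ d.π b = s.proj b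
    rw [Preadditive.sum_comp, Finset.sum_eq_single b]
    · rw [assoc, d.ι_π_self, comp_id]
    · intro a _ hab
      rw [assoc, d.ι_π_ne a b hab, comp_zero]
    · simp
  · refine d.hom_ext (fun b => (hm b).trans ?_)
    rw [Preadditive.sum_comp, Finset.sum_eq_single b]
    · rw [assoc, d.ι_π_self, comp_id]
    · intro a _ hab
      rw [assoc, d.ι_π_ne a b hab, comp_zero]
    · simp

variable (H) in
lemma prop_of_isZero_of_isClosedUnderFiniteProducts {X : C} (hX : IsZero X) : H X := by
  let d : Decomp X (fun a : Empty => a.elim) :=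
    { ι := fun a => a.elim
      π := fun a => a.elim
      ι_π_self := fun a => a.elim
      ι_π_ne := fun a => a.elim
      total := hX.eq_of_src _ _ }
  exact d.prop (fun a => a.elim)

end

section Generated

/-- A class of objects without negative extensions. -/
def HomNegZero (H : ObjectProperty C) : Prop :=
  ∀ (X Y : C), H X → H Y → ∀ n : ℤ, n < 0 → ∀ f : X ⟶ Y⟦n⟧, f = 0

variable {H : ObjectProperty C}

lemma HomNegZero.shift (hH : HomNegZero H) {X Y : C} (hX : H X) (hY : H Y) {n m : ℤ}
    (h : m < n) (f : X⟦n⟧ ⟶ Y⟦m⟧) : f = 0 :=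
  hom_eq_zero_of_shift_left n m (m - n) (by lia) (hH X Y hX hY _ (by lia)) f

variable (H) in
/-- The objects generated by the shifts `Y[m]` with `Y` in `H` and `m ≥ -n`. -/
def genLE (n : ℤ) : ObjectProperty C :=
  fun X => ∀ (Y : C) (m : ℤ), H Y → m < -n → ∀ f : X ⟶ Y⟦m⟧, f = 0

variable (H) in
/-- The objects generated by the shifts `Y[m]` with `Y` in `H` and `m ≤ -n`. -/
def genGE (n : ℤ) : ObjectProperty C :=
  fun X => ∀ (Y : C) (m : ℤ), H Y → -n < m → ∀ f : Y⟦m⟧ ⟶ X, f = 0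

variable (hH : HomNegZero H) (hgen : addClosure (unionShifts H) = ⊤)
include hH hgen

lemma exists_genDecomp (X : C) : ∃ (J : Type) (_ : Fintype J) (Z : J → C) (m : J → ℤ)
    (_ : Decomp X (fun a => (Z a)⟦m a⟧)), ∀ a, H (Z a) := by
  rw [← addClosure_unionShifts_iff, hgen]
  trivial

lemma genLE_genGE_zero ⦃X Y : C⦄ (f : X ⟶ Y) (hX : genLE H 0 X) (hY : genGE H 1 Y) : f = 0 := by
  obtain ⟨J, _, Z, m, d, hZ⟩ := exists_genDecomp hH hgen X
  rw [← id_comp f, ← d.total, Preadditive.sum_comp]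
  refine Finset.sum_eq_zero (fun a _ => ?_)
  rw [assoc]
  by_cases h : m a < 0
  · rw [hX _ _ (hZ a) (by lia) (d.π a), zero_comp]
  · rw [hY _ _ (hZ a) (by lia) (d.ι a ≫ f), comp_zero]

lemma exists_gen_splitting (X : C) :
    ∃ (X₁ X₂ : C) (_ : Splitting X X₁ X₂), genLE H 0 X₁ ∧ genGE H 1 X₂ := by
  obtain ⟨J, _, Z, m, d, hZ⟩ := exists_genDecomp hH hgen X
  -- The shift `Z⟦m⟧` sits in degree `-m`, so the non-negative shifts form the part `≤ 0`.
  refine ⟨_, _, d.splitting (fun a => 0 ≤ m a), ?_, ?_⟩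
  · intro Y n hY hn f
    apply biproduct.hom_ext'
    intro a
    rw [comp_zero]
    exact hH.shift (hZ _) hY (by have := a.2; lia) _
  · intro Y n hY hn f
    apply biproduct.hom_ext
    intro a
    rw [zero_comp]
    exact hH.shift hY (hZ _) (by have := a.2; lia) _

/-- The t-structure on a category generated by the shifts of a class of objects without negative
extensions. -/
noncomputable def genTStructure : TStructure C where
  le := genLE H
  ge := genGE H
  le_isClosedUnderIsomorphisms n := ⟨fun e hX Y m hY hm f => by
    rw [← cancel_epi e.hom, hX Y m hY hm (e.hom ≫ f), comp_zero]⟩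
  ge_isClosedUnderIsomorphisms n := ⟨fun e hX Y m hY hm f => by
    rw [← cancel_mono e.inv, hX Y m hY hm (f ≫ e.inv), zero_comp]⟩
  le_shift n a n' h X hX := fun Y m hY hm f =>
    hom_eq_zero_of_shift_left a m (m - a) (by lia) (hX Y (m - a) hY (by lia)) f
  ge_shift n a n' h X hX := fun Y m hY hm f =>
    hom_eq_zero_of_shift_right a m (m - a) (by lia) (hX Y (m - a) hY (by lia)) f
  zero' := genLE_genGE_zero hH hgen
  le_zero_le X hX := fun Y m hY hm f => hX Y m hY (by lia) f
  ge_one_le X hX := fun Y m hY hm f => hX Y m hY (by lia) f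
  exists_triangle_zero_one X := by
    obtain ⟨X₁, X₂, S, h₁, h₂⟩ := exists_gen_splitting hH hgen X
    exact ⟨X₁, X₂, h₁, h₂, _, _, _, S.dist⟩

lemma genTStructure_isBounded : IsBounded (genTStructure hH hgen) := by
  intro X
  obtain ⟨J, _, Z, m, d, hZ⟩ := exists_genDecomp hH hgen X
  have bound (a : J) : |m a| ≤ ((∑ a, (m a).natAbs : ℕ) : ℤ) := by
    rw [Int.abs_eq_natAbs]
    exact_mod_cast Finset.single_le_sum (f := fun a => (m a).natAbs) (fun _ _ => Nat.zero_le _)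
      (Finset.mem_univ a)
  refine ⟨∑ a, (m a).natAbs, fun Y n hY hn f => d.hom_ext (fun a => ?_),
    fun Y n hY hn f => d.hom_ext' (fun a => ?_)⟩
  · have h₁ := abs_le.1 (bound a)
    rw [zero_comp]
    exact hH.shift hY (hZ a) (by lia) _
  · have h₁ := abs_le.1 (bound a)
    rw [comp_zero]
    exact hH.shift (hZ a) hY (by lia) _

/-- Truncating `X` shows that `f` is a split epimorphism: `f` kills the part `≤ 0`, the projection
to the part `≥ 1` extends along `f` to `r`, and `r ≫ S.inr` is then a section of `f`. Since `f ≫ δ =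
0`, this forces `δ = 0`. -/
lemma genTStructure_isSplit : IsSplit (genTStructure hH hgen) := by
  intro X Xp Xm f δ g D hp hm
  let t := genTStructure hH hgen
  have hp' : t.IsGE Xp 1 := ⟨hp⟩
  have hm' : t.IsLE Xm (-1) := ⟨hm⟩
  obtain ⟨X₁, X₂, S, h₁, h₂⟩ := exists_gen_splitting hH hgen X
  have h₁' : t.IsLE X₁ 0 := ⟨h₁⟩
  have h₂' : t.IsGE X₂ 1 := ⟨h₂⟩
  have := t.isGE_shift X₂ 1 1 0
  obtain ⟨r, hr⟩ := Dist.desc₁ D S.snd (t.zero _ (-1) 0)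
  have hf : f = S.snd ≫ S.inr ≫ f := by
    apply S.hom_ext'
    · simp [t.zero (S.inl ≫ f) 0 1]
    · simp
  obtain ⟨w, hw⟩ := Dist.desc₂ D (r ≫ S.inr ≫ f - 𝟙 Xp) (by
    rw [Preadditive.comp_sub, ← assoc, ← hr, ← hf, comp_id, sub_self])
  rw [t.zero w (-1) 1, comp_zero, sub_eq_zero] at hw
  have h0 : f ≫ δ = 0 := Dist.comp₁₂ D
  rw [← id_comp δ, ← hw, assoc, assoc, h0, comp_zero, comp_zero]

/-- For an object of the heart, a summand with nonzero shift has zero projection or zero inclusion,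
hence is zero; what remains is a finite sum of objects of `H`. -/
lemma genTStructure_heart (hc : H.IsClosedUnderFiniteProducts) :
    (genTStructure hH hgen).heart = H := by
  ext X
  constructor
  · rintro ⟨h₁, h₂⟩
    obtain ⟨J, _, Z, m, d, hZ⟩ := exists_genDecomp hH hgen X
    refine d.prop (fun a => ?_)
    rcases lt_trichotomy (m a) 0 with h | h | h
    · refine prop_of_isZero_of_isClosedUnderFiniteProducts H ?_
      rw [IsZero.iff_id_eq_zero, ← d.ι_π_self a, h₁ _ _ (hZ a) (by lia) (d.π a), comp_zero]
    · refine ((Decomp.self (Z a)).ofIso ?_ (fun _ => Iso.refl _)).prop (fun _ => hZ a)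
      rw [h]
      exact (shiftFunctorZero C ℤ).app _
    · refine prop_of_isZero_of_isClosedUnderFiniteProducts H ?_
      rw [IsZero.iff_id_eq_zero, ← d.ι_π_self a, h₂ _ _ (hZ a) (by lia) (d.ι a), zero_comp]
  · intro hX
    have hX₀ := (shiftFunctorZero C ℤ).app X
    refine ⟨fun Y m hY hm f => hH X Y hX hY m (by lia) f, fun Y m hY hm f => ?_⟩
    rw [← cancel_mono hX₀.inv, zero_comp]
    exact hH.shift hY hX (by lia) _

end Generated

end

/-! ### Dévissage for bounded objects. -/

section Devissage

variable {C : Type u} [Category.{v} C] [Preadditive C] [HasZeroObject C] [HasShift C ℤ]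
  [∀ n : ℤ, (shiftFunctor C n).Additive] [Pretriangulated C] [CategoryTheory.IsTriangulated C]
  {t : TStructure C}

/-- A property which is stable under extensions and holds in each single degree holds for all
bounded objects. -/
lemma bounded_induction (Q : C → Prop)
    (hQ : ∀ ⦃X Y Z : C⦄ (f : X ⟶ Y) (g : Y ⟶ Z) (h : Z ⟶ X⟦(1 : ℤ)⟧), Dist f g h →
      Q X → Q Z → Q Y) (n : ℤ) (k : ℕ)
    (h : ∀ (j : ℤ), n ≤ j → j ≤ n + k → ∀ X, t.IsGE X j → t.IsLE X j → Q X) :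
    ∀ X, t.IsGE X n → t.IsLE X (n + k) → Q X := by
  induction k with
  | zero =>
    intro X h₁ h₂
    exact h n (by lia) (by lia) X h₁ (by simpa using h₂)
  | succ k hk =>
    intro X h₁ h₂
    have h₂' : t.IsLE X (n + k + 1) := by rw [add_assoc]; exact_mod_cast h₂
    refine hQ _ _ _ (t.triangleLEGE_distinguished (n + k) (n + k + 1) rfl X) ?_ ?_
    · exact hk (fun j hj hj' => h j hj (by push_cast; lia)) ((t.truncLE (n + k)).obj X)
        inferInstance inferInstance
    · exact h (n + k + 1) (by lia) (by push_cast; lia) ((t.truncGE (n + k + 1)).obj X)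
        inferInstance inferInstance

/-- Dévissage in both variables reduces to objects in single degrees `j` and `i` with `j - i ≥ 2`.
-/
lemma homGap_of_heart (hb : IsBounded t)
    (h : ∀ (X Y : C), t.heart X → t.heart Y → ∀ n : ℤ, 2 ≤ n → ∀ f : X ⟶ Y⟦n⟧, f = 0) :
    HomGap t := by
  intro X Y f n m hX hY hnm
  obtain ⟨a, -, ha⟩ := hb X
  obtain ⟨b, hb, -⟩ := hb Y
  obtain ⟨k, hk⟩ : ∃ k : ℕ, (a : ℤ) ≤ n + k := ⟨(a - n).toNat, by lia⟩
  obtain ⟨l, hl⟩ : ∃ l : ℕ, m - l ≤ -b := ⟨(m + b).toNat, by lia⟩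
  have : t.IsLE X a := ⟨ha⟩
  have : t.IsGE Y (-b) := ⟨hb⟩
  refine bounded_induction (t := t) (fun X => ∀ f : X ⟶ Y, f = 0) ?_ n k ?_ X hX
    (t.isLE_of_le X a (n + k)) f
  · intro X₁ X₂ X₃ u v w H h₁ h₃ f
    obtain ⟨g, hg⟩ := H.desc₂ f (h₁ _)
    rw [hg, h₃ g, comp_zero]
  intro j hj _ X hX₁ hX₂
  refine bounded_induction (t := t) (fun Y => ∀ f : X ⟶ Y, f = 0) ?_ (m - l) l ?_ Y
    (t.isGE_of_ge Y (m - l) (-b)) (by simpa using hY)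
  · intro X₁ X₂ X₃ u v w H h₁ h₃ f
    obtain ⟨g, hg⟩ := H.lift₂ f (h₃ _)
    rw [hg, h₁ g, zero_comp]
  intro i _ hi Y hY₁ hY₂ f
  have hX' : t.heart (X⟦j⟧) := by
    rw [t.mem_heart_iff]
    exact ⟨t.isLE_shift X j j 0, t.isGE_shift X j j 0⟩
  have hY' : t.heart (Y⟦i⟧) := by
    rw [t.mem_heart_iff]
    exact ⟨t.isLE_shift Y i i 0, t.isGE_shift Y i i 0⟩
  apply (shiftFunctor C j).map_injective
  rw [Functor.map_zero, ← cancel_mono ((shiftFunctorAdd' C i (j - i) j (by lia)).hom.app Y),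
    zero_comp]
  exact h _ _ hX' hY' (j - i) (by lia) _

end Devissage

/-! ### Abelian categories embedded as hearts. -/

section HeartInclusion

variable {A : Type u'} [Category.{v'} A] [Abelian A]
  {C : Type u} [Category.{v} C] [Preadditive C] [HasZeroObject C] [HasShift C ℤ]
  [∀ n : ℤ, (shiftFunctor C n).Additive] [Pretriangulated C]

/-- A fully faithful functor from an abelian category to a triangulated category which
identifies short exact sequences with distinguished triangles. -/
structure IsHeartInclusion (i : A ⥤ C) : Prop where
  full : i.Full
  faithful : i.Faithful
  additive : i.Additive
  hom_neg ⦃X Y : A⦄ ⦃n : ℤ⦄ (f : i.obj X ⟶ (i.obj Y)⟦n⟧) (hn : n < 0) : f = 0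
  ses ⦃X Y Z : A⦄ (f : X ⟶ Y) (g : Y ⟶ Z) (w : f ≫ g = 0) (h : (ShortComplex.mk f g w).ShortExact) :
    ∃ δ, Dist (i.map f) (i.map g) δ
  ext ⦃X Y : A⦄ (e : i.obj X ⟶ (i.obj Y)⟦(1 : ℤ)⟧) :
    ∃ (E : A) (a : Y ⟶ E) (b : E ⟶ X), Dist (i.map a) (i.map b) e

namespace IsHeartInclusion

lemma hom_pos {i : A ⥤ C} (hi : IsHeartInclusion i) {X Y : A} {n : ℤ}
    (f : (i.obj X)⟦n⟧ ⟶ i.obj Y) (hn : 0 < n) : f = 0 :=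
  AbelianSubcategory.eq_zero_of_hom_shift_pos hi.hom_neg f hn

lemma shortExact {i : A ⥤ C} (hi : IsHeartInclusion i) {X Y Z : A} {f : X ⟶ Y} {g : Y ⟶ Z}
    {δ : i.obj Z ⟶ (i.obj X)⟦(1 : ℤ)⟧} (H : Dist (i.map f) (i.map g) δ) :
    ∃ w : f ≫ g = 0, (ShortComplex.mk f g w).ShortExact := by
  have := hi.full
  have := hi.faithful
  have := hi.additive
  have h₁ := AbelianSubcategory.isLimitKernelForkOfDistTriang hi.hom_neg f g δ H
  have h₂ := AbelianSubcategory.isColimitCokernelCoforkOfDistTriang hi.hom_neg f g δ H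
  have w : f ≫ g = 0 := i.map_injective (by rw [i.map_comp, H.comp₁₂, i.map_zero])
  refine ⟨w, ShortComplex.ShortExact.mk' (ShortComplex.exact_of_f_is_kernel (.mk f g w) h₁) ?_ ?_⟩
  · exact mono_of_isLimit_fork h₁
  · exact epi_of_isColimit_cofork h₂

variable [CategoryTheory.IsTriangulated C]

/-- The cone of a morphism of the heart lives in degrees `-1` and `0`; its truncation triangle
exhibits the kernel and the cokernel. -/
lemma admissible (t : TStructure C) {B : Type u'} [Category.{v'} B] (i : B ⥤ C)
    (h : ∀ X, t.heart X ↔ i.essImage X) : AbelianSubcategory.admissibleMorphism i = ⊤ := by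
  ext X₁ X₂ f
  refine ⟨fun _ => trivial, fun _ X₃ f₂ f₃ H => ?_⟩
  have h₁ := (t.mem_heart_iff _).1 ((h _).2 (i.obj_mem_essImage X₁))
  have h₂ := (t.mem_heart_iff _).1 ((h _).2 (i.obj_mem_essImage X₂))
  have h₁₁ := h₁.1
  have h₁₂ := h₁.2
  have h₂₂ := h₂.2
  have := t.isLE_shift (i.obj X₁) 0 1 (-1)
  have := t.isGE_shift (i.obj X₁) 0 1 (-1)
  have h₃ : t.IsLE X₃ 0 := (Dist.rot H).isLE₂ t 0 h₂.1 (t.isLE_of_le _ (-1) 0)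
  have h₃' : t.IsGE X₃ (-1) := (Dist.rot H).isGE₂ t (-1) (t.isGE_of_ge _ (-1) 0) inferInstance
  obtain ⟨δ, H'⟩ : ∃ δ : (t.truncGE 0).obj X₃ ⟶ ((t.truncLE (-1)).obj X₃)⟦(1 : ℤ)⟧,
      Dist ((t.truncLEι (-1)).app X₃) ((t.truncGEπ 0).app X₃) δ :=
    ⟨_, t.triangleLEGE_distinguished (-1) 0 (by lia) X₃⟩
  have hK : t.heart (((t.truncLE (-1)).obj X₃)⟦(-1 : ℤ)⟧) := by
    rw [t.mem_heart_iff]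
    exact ⟨t.isLE_shift _ (-1) (-1) 0, t.isGE_shift _ (-1) (-1) 0⟩
  have hQ : t.heart ((t.truncGE 0).obj X₃) := by
    rw [t.mem_heart_iff]
    constructor <;> infer_instance
  obtain ⟨K, ⟨eK⟩⟩ := (h _).1 hK
  obtain ⟨Q, ⟨eQ⟩⟩ := (h _).1 hQ
  let e : (i.obj K)⟦(1 : ℤ)⟧ ≅ (t.truncLE (-1)).obj X₃ :=
    (shiftFunctor C (1 : ℤ)).mapIso eK ≪≫ shiftNegShift _ (1 : ℤ)
  refine ⟨K, Q, e.hom ≫ (t.truncLEι (-1)).app X₃, (t.truncGEπ 0).app X₃ ≫ eQ.inv,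
    eQ.hom ≫ δ ≫ e.inv⟦(1 : ℤ)⟧', H'.of_iso e (Iso.refl _) eQ (by simp) (by simp) ?_⟩
  simp only [assoc, ← Functor.map_comp, Iso.inv_hom_id, CategoryTheory.Functor.map_id, comp_id]

lemma hom_neg_of_heart (t : TStructure C) {B : Type u'} [Category.{v'} B] (i : B ⥤ C)
    (h : ∀ X, t.heart X ↔ i.essImage X) ⦃X Y : B⦄ ⦃n : ℤ⦄ (f : i.obj X ⟶ (i.obj Y)⟦n⟧)
    (hn : n < 0) : f = 0 := by
  have h₁ := ((t.mem_heart_iff _).1 ((h _).2 (i.obj_mem_essImage X))).1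
  have h₂ := ((t.mem_heart_iff _).1 ((h _).2 (i.obj_mem_essImage Y))).2
  have := t.isGE_shift (i.obj Y) 0 n (-n)
  exact t.zero f 0 (-n)

/-- The inclusion of the heart of a t-structure. -/
lemma of_heart (t : TStructure C) (i : A ⥤ C) [i.Full] [i.Faithful] [i.Additive]
    (h : ∀ X, t.heart X ↔ i.essImage X) : IsHeartInclusion i where
  full := inferInstance
  faithful := inferInstance
  additive := inferInstance
  hom_neg := hom_neg_of_heart t i h
  ses X Y Z f g w hS := by
    have := hS.epi_g
    have := hS.mono_f
    dsimp only at *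
    -- The triangle on `g` has a kernel of `g` as first term, so it can be replaced by the given
    -- kernel `f`.
    obtain ⟨K, k, δ, H⟩ := AbelianSubcategory.exists_distinguished_triangle_of_epi
      (hom_neg_of_heart t i h) (admissible t i h) g
    have H' : Dist (i.map k) (i.map g) δ := H
    have hkg : k ≫ g = 0 := i.map_injective (by rw [i.map_comp, H'.comp₁₂, i.map_zero])
    obtain ⟨u, hu⟩ : ∃ u : X ⟶ K, f = u ≫ k := by
      obtain ⟨u, hu⟩ := H'.lift₂ (i.map f) (by rw [← i.map_comp, w, i.map_zero])
      obtain ⟨u, rfl⟩ := i.map_surjective u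
      exact ⟨u, i.map_injective (by rw [hu, i.map_comp])⟩
    obtain ⟨v, hv⟩ : ∃ v : K ⟶ X, k = v ≫ f :=
      ⟨hS.exact.lift k hkg, (hS.exact.lift_f k hkg).symm⟩
    have huv : u ≫ v = 𝟙 X := by
      rw [← cancel_mono f, assoc, ← hv, ← hu, id_comp]
    have hk : Mono k :=
      mono_of_isLimit_fork (AbelianSubcategory.isLimitKernelForkOfDistTriang
        (hom_neg_of_heart t i h) k g δ H)
    have hvu : v ≫ u = 𝟙 K := by
      rw [← cancel_mono k, assoc, ← hu, ← hv, id_comp]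
    refine ⟨δ ≫ (i.map v)⟦(1 : ℤ)⟧', H'.of_iso (i.mapIso ⟨u, v, huv, hvu⟩) (Iso.refl _)
      (Iso.refl _) ?_ (by simp) ?_⟩
    · simp [hu]
    · simp [← Functor.map_comp, hvu]
  ext X Y e := by
    obtain ⟨E, a, b, H⟩ := exists_dist₁₂ e
    have h₁ := (t.mem_heart_iff _).1 ((h _).2 (i.obj_mem_essImage X))
    have h₂ := (t.mem_heart_iff _).1 ((h _).2 (i.obj_mem_essImage Y))
    obtain ⟨E', ⟨u⟩⟩ := (h E).1 (by
      rw [t.mem_heart_iff]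
      exact ⟨H.isLE₂ t 0 h₂.1 h₁.1, H.isGE₂ t 0 h₂.2 h₁.2⟩)
    refine ⟨E', i.preimage (a ≫ u.inv), i.preimage (u.hom ≫ b),
      H.of_iso (Iso.refl _) u (Iso.refl _) ?_ ?_ ?_⟩ <;> simp

end IsHeartInclusion

end HeartInclusion

/-! ### Transport of extension classes through short exact sequences. -/

section ExtRel

variable {A : Type u'} [Category.{v'} A] [Abelian A]
  {D : Type u} [Category.{v} D] [Preadditive D] [HasZeroObject D] [HasShift D ℤ]
  [∀ n : ℤ, (shiftFunctor D n).Additive] [Pretriangulated D]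
  {T : Type w} [Category.{w'} T] [Preadditive T] [HasZeroObject T] [HasShift T ℤ]
  [∀ n : ℤ, (shiftFunctor T n).Additive] [Pretriangulated T]
  {i : A ⥤ D} {j : A ⥤ T}

variable (i j) in
/-- The extension classes `e` and `e'` are represented by the same short exact sequence. -/
def ExtRel {X Y : A} (e : i.obj X ⟶ (i.obj Y)⟦(1 : ℤ)⟧) (e' : j.obj X ⟶ (j.obj Y)⟦(1 : ℤ)⟧) :
    Prop :=
  ∃ (E : A) (a : Y ⟶ E) (b : E ⟶ X), Dist (i.map a) (i.map b) e ∧ Dist (j.map a) (j.map b) e'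

namespace ExtRel

lemma symm {X Y : A} {e : i.obj X ⟶ (i.obj Y)⟦(1 : ℤ)⟧} {e' : j.obj X ⟶ (j.obj Y)⟦(1 : ℤ)⟧}
    (h : ExtRel i j e e') : ExtRel j i e' e := by
  obtain ⟨E, a, b, h₁, h₂⟩ := h
  exact ⟨E, a, b, h₂, h₁⟩

variable (hi : IsHeartInclusion i) (hj : IsHeartInclusion j)
include hi hj

lemma exists_right {X Y : A} (e : i.obj X ⟶ (i.obj Y)⟦(1 : ℤ)⟧) : ∃ e', ExtRel i j e e' := by
  obtain ⟨E, a, b, H⟩ := hi.ext e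
  obtain ⟨w, hw⟩ := hi.shortExact H
  obtain ⟨e', H'⟩ := hj.ses a b w hw
  exact ⟨e', E, a, b, H, H'⟩

lemma exists_left {X Y : A} (e' : j.obj X ⟶ (j.obj Y)⟦(1 : ℤ)⟧) : ∃ e, ExtRel i j e e' := by
  obtain ⟨e, h⟩ := exists_right hj hi e'
  exact ⟨e, h.symm⟩

/-- A morphism of extensions in `D` comes from one in `A` by fullness and can be replayed in `T`.
The third component found there is `j.map u`, because the difference factors through a morphism from
a positive shift and so is zero. -/
lemma naturality {X Y X₂ Y₂ : A} {e : i.obj X ⟶ (i.obj Y)⟦(1 : ℤ)⟧}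
    {e' : j.obj X ⟶ (j.obj Y)⟦(1 : ℤ)⟧} (h : ExtRel i j e e')
    {e₂ : i.obj X₂ ⟶ (i.obj Y₂)⟦(1 : ℤ)⟧}
    {e₂' : j.obj X₂ ⟶ (j.obj Y₂)⟦(1 : ℤ)⟧} (h₂ : ExtRel i j e₂ e₂') (u : X ⟶ X₂) (v : Y ⟶ Y₂)
    (comm : e ≫ (i.map v)⟦(1 : ℤ)⟧' = i.map u ≫ e₂) :
    e' ≫ (j.map v)⟦(1 : ℤ)⟧' = j.map u ≫ e₂' := by
  obtain ⟨E, a, b, H, H'⟩ := h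
  obtain ⟨E₂, a₂, b₂, H₂, H₂'⟩ := h₂
  have := hi.full
  have := hi.faithful
  obtain ⟨w, hw₁, hw₂⟩ := H.complete₂ H₂ (i.map v) (i.map u) comm
  obtain ⟨w, rfl⟩ := i.map_surjective w
  rw [← i.map_comp, ← i.map_comp] at hw₁ hw₂
  replace hw₁ := i.map_injective hw₁
  replace hw₂ := i.map_injective hw₂
  obtain ⟨c, hc₁, hc₂⟩ := H'.complete₃ H₂' (j.map v) (j.map w) (by
    rw [← j.map_comp, hw₁, j.map_comp])
  obtain ⟨ψ, hψ⟩ := H'.desc₃ (c - j.map u) (by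
    rw [Preadditive.comp_sub, hc₁, ← j.map_comp, ← j.map_comp, hw₂, sub_self])
  rw [hj.hom_pos ψ (by lia), comp_zero, sub_eq_zero] at hψ
  rw [hc₂, hψ]

lemma right_unique {X Y : A} {e : i.obj X ⟶ (i.obj Y)⟦(1 : ℤ)⟧}
    {e' e'' : j.obj X ⟶ (j.obj Y)⟦(1 : ℤ)⟧} (h : ExtRel i j e e') (h' : ExtRel i j e e'') :
    e' = e'' := by
  simpa using naturality hi hj h h' (𝟙 X) (𝟙 Y) (by simp)

lemma left_unique {X Y : A} {e e₂ : i.obj X ⟶ (i.obj Y)⟦(1 : ℤ)⟧}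
    {e' : j.obj X ⟶ (j.obj Y)⟦(1 : ℤ)⟧} (h : ExtRel i j e e') (h' : ExtRel i j e₂ e') :
    e = e₂ :=
  right_unique hj hi h.symm h'.symm

/-- Extension classes may be pulled back along a morphism. -/
lemma comp_left {X Y W : A} {e : i.obj X ⟶ (i.obj Y)⟦(1 : ℤ)⟧}
    {e' : j.obj X ⟶ (j.obj Y)⟦(1 : ℤ)⟧} (h : ExtRel i j e e') (u : W ⟶ X) :
    ExtRel i j (i.map u ≫ e) (j.map u ≫ e') := by
  obtain ⟨s, hs⟩ := exists_right hi hj (i.map u ≫ e)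
  have := naturality hi hj hs h u (𝟙 Y) (by simp)
  simp only [CategoryTheory.Functor.map_id, comp_id] at this
  rwa [← this]

/-- Extension classes may be pushed out along a morphism. -/
lemma comp_right {X Y W : A} {e : i.obj X ⟶ (i.obj Y)⟦(1 : ℤ)⟧}
    {e' : j.obj X ⟶ (j.obj Y)⟦(1 : ℤ)⟧} (h : ExtRel i j e e') (v : Y ⟶ W) :
    ExtRel i j (e ≫ (i.map v)⟦(1 : ℤ)⟧') (e' ≫ (j.map v)⟦(1 : ℤ)⟧') := by
  obtain ⟨s, hs⟩ := exists_right hi hj (e ≫ (i.map v)⟦(1 : ℤ)⟧')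
  have := naturality hi hj h hs (𝟙 X) v (by simp)
  simp only [CategoryTheory.Functor.map_id, id_comp] at this
  rwa [this]

lemma zero (X Y : A) : ExtRel i j (0 : i.obj X ⟶ (i.obj Y)⟦(1 : ℤ)⟧) 0 := by
  have := hi.additive
  have := hj.additive
  obtain ⟨s, hs⟩ := exists_right hi hj (0 : i.obj X ⟶ (i.obj Y)⟦(1 : ℤ)⟧)
  simpa using comp_left hi hj hs 0

/-- Baer sum: both classes are restrictions of one class on `X ⊞ X`, and restriction along the
diagonal gives the sum. -/
lemma add {X Y : A} {e₁ e₂ : i.obj X ⟶ (i.obj Y)⟦(1 : ℤ)⟧}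
    {e₁' e₂' : j.obj X ⟶ (j.obj Y)⟦(1 : ℤ)⟧} (h₁ : ExtRel i j e₁ e₁') (h₂ : ExtRel i j e₂ e₂') :
    ExtRel i j (e₁ + e₂) (e₁' + e₂') := by
  have := hi.additive
  have := hj.additive
  obtain ⟨s, hs⟩ := exists_right hi hj
    (i.map (biprod.fst : X ⊞ X ⟶ X) ≫ e₁ + i.map (biprod.snd : X ⊞ X ⟶ X) ≫ e₂)
  have k₁ := comp_left hi hj hs biprod.inl
  have k₂ := comp_left hi hj hs biprod.inr
  have k := comp_left hi hj hs (biprod.inl + biprod.inr)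
  simp only [Preadditive.comp_add, ← i.map_comp_assoc, biprod.inl_fst, biprod.inl_snd,
    biprod.inr_fst, biprod.inr_snd, CategoryTheory.Functor.map_id, Functor.map_zero, id_comp, zero_comp,
    add_zero, zero_add, Functor.map_add, Preadditive.add_comp] at k₁ k₂ k
  rwa [right_unique hi hj k₁ h₁, right_unique hi hj k₂ h₂] at k

end ExtRel

end ExtRel

/-! ### Positive extension classes in the derived category are effaceable. -/

section Effaceable

open HomologicalComplex

variable {A : Type u} [Category.{v} A] [Abelian A]

/-- In the top degree everything is a cycle, so the morphism is the projection to homology followed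
by an isomorphism. -/
lemma epi_f_comp_of_quasiIsoAt {X : A} {K : CochainComplex A ℤ} {n : ℤ}
    (π : K ⟶ (single A (ComplexShape.up ℤ) n).obj X) [K.IsStrictlyLE n] [QuasiIsoAt π n] :
    Epi (π.f n ≫ (singleObjXSelf (ComplexShape.up ℤ) n X).hom) := by
  let e := K.iCyclesIso n (n + 1) (by simp)
    ((K.isZero_of_isStrictlyLE n (n + 1) (by simp)).eq_of_tgt _ _)
  have : π.f n ≫ (singleObjXSelf (ComplexShape.up ℤ) n X).hom =
      e.inv ≫ K.homologyπ n ≫ homologyMap π n ≫ (singleObjHomologySelfIso _ _ _).hom := by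
    have he : e.hom = K.iCycles n := rfl
    rw [← cancel_epi e.hom, e.hom_inv_id_assoc, homologyπ_naturality_assoc,
      homologyπ_singleObjHomologySelfIso_hom, he, ← cyclesMap_i_assoc]
    congr 1
  rw [this]
  have : Epi (K.homologyπ n) := inferInstance
  infer_instance

/-- The cover is the top term `K.X 0`. It is a subcomplex of `K`, and `g` vanishes on it because `L`
is zero in degree 0. -/
lemma exists_epi_comp_eq_zero_of_quasiIso {X : A} {K L : CochainComplex A ℤ}
    (π : K ⟶ (single A (ComplexShape.up ℤ) 0).obj X) [QuasiIso π] (g : K ⟶ L)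
    [K.IsStrictlyLE 0] (n : ℤ) (hn : n < 0) [L.IsStrictlyLE n] :
    ∃ (X' : A) (p : X' ⟶ X) (s : (single A (ComplexShape.up ℤ) 0).obj X' ⟶ K),
      Epi p ∧ s ≫ π = (single A (ComplexShape.up ℤ) 0).map p ∧ s ≫ g = 0 := by
  refine ⟨K.X 0, _, mkHomFromSingle (𝟙 _) ?_, epi_f_comp_of_quasiIsoAt π, ?_, ?_⟩
  · rintro _ rfl
    apply (K.isZero_of_isStrictlyLE 0 (0 + 1) (by simp)).eq_of_tgt
  · apply HomologicalComplex.from_single_hom_ext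
    rw [comp_f, mkHomFromSingle_f, single_map_f_self]
    simp
  · apply HomologicalComplex.from_single_hom_ext
    apply (L.isZero_of_isStrictlyLE n 0 hn).eq_of_tgt

variable [HasDerivedCategory.{w} A]

lemma exists_epi_comp_eq_zero {X : A} {L : CochainComplex A ℤ}
    (φ : DerivedCategory.Q.obj ((single A (ComplexShape.up ℤ) 0).obj X) ⟶
      DerivedCategory.Q.obj L) (n : ℤ) (hn : n < 0) [L.IsStrictlyLE n] :
    ∃ (X' : A) (p : X' ⟶ X), Epi p ∧
      DerivedCategory.Q.map ((single A (ComplexShape.up ℤ) 0).map p) ≫ φ = 0 := by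
  obtain ⟨K, _, π, h, g, rfl⟩ := DerivedCategory.right_fac_of_isStrictlyLE φ 0
  have hπ : QuasiIso π := by rwa [DerivedCategory.isIso_Q_map_iff_quasiIso] at h
  obtain ⟨X', p, s, hp, h₁, h₂⟩ := exists_epi_comp_eq_zero_of_quasiIso π g n hn
  refine ⟨X', p, hp, ?_⟩
  rw [← h₁, Functor.map_comp, assoc, IsIso.hom_inv_id_assoc, ← Functor.map_comp, h₂,
    Functor.map_zero]

lemma exists_epi_comp_singleFunctor_eq_zero {X Y : A} (n : ℤ) (hn : 0 < n)
    (φ : (DerivedCategory.singleFunctor A 0).obj X ⟶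
      ((DerivedCategory.singleFunctor A 0).obj Y)⟦n⟧) :
    ∃ (X' : A) (p : X' ⟶ X), Epi p ∧ (DerivedCategory.singleFunctor A 0).map p ≫ φ = 0 := by
  let e := ((DerivedCategory.singleFunctors A).shiftIso n (-n) 0 (by lia)).app Y
  obtain ⟨X', p, hp, h⟩ := exists_epi_comp_eq_zero
    (L := (CochainComplex.singleFunctor A (-n)).obj Y) (φ ≫ e.hom) (-n) (by lia)
  refine ⟨X', p, hp, ?_⟩
  rw [← cancel_mono e.hom, assoc, zero_comp]
  exact h

end Effaceable

/-! ### Heredity tested in an ambient triangulated category. -/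

section Hereditary

open DerivedCategory

variable {A : Type u} [Category.{v} A] [Abelian A]

lemma singleFunctor_heart [HasDerivedCategory.{w} A] (X : DerivedCategory A) :
    (TStructure.t (C := A)).heart X ↔ (singleFunctor A 0).essImage X := by
  rw [TStructure.mem_heart_iff]
  constructor
  · rintro ⟨h₁, h₂⟩
    obtain ⟨Y, ⟨e⟩⟩ := exists_iso_singleFunctor_obj_of_isGE_of_isLE X 0
    exact ⟨Y, ⟨e.symm⟩⟩
  · rintro ⟨Y, ⟨e⟩⟩
    exact ⟨TStructure.t.isLE_of_iso e 0, TStructure.t.isGE_of_iso e 0⟩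

lemma singleFunctor_isHeartInclusion [HasDerivedCategory.{w} A] :
    IsHeartInclusion (singleFunctor A 0) :=
  .of_heart TStructure.t _ singleFunctor_heart

variable {T : Type u'} [Category.{v'} T] [Preadditive T] [HasZeroObject T] [HasShift T ℤ]
  [∀ n : ℤ, (shiftFunctor T n).Additive] [Pretriangulated T]

/-- Every positive extension class is a product of an extension of degree one with one of lower
degree. -/
lemma exists_singleFunctor_factorization [HasDerivedCategory.{w} A] {X Y : A} (n m : ℤ)
    (hm : n + 1 = m) (hn : 0 < m)
    (φ : (singleFunctor A 0).obj X ⟶ ((singleFunctor A 0).obj Y)⟦m⟧) :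
    ∃ (X' K : A) (k : K ⟶ X') (p : X' ⟶ X) (w : k ≫ p = 0)
      (_ : (ShortComplex.mk k p w).ShortExact)
      (δ : (singleFunctor A 0).obj X ⟶ ((singleFunctor A 0).obj K)⟦(1 : ℤ)⟧)
      (ψ : (singleFunctor A 0).obj K ⟶ ((singleFunctor A 0).obj Y)⟦n⟧),
      Dist ((singleFunctor A 0).map k) ((singleFunctor A 0).map p) δ ∧
      φ = δ ≫ ψ⟦(1 : ℤ)⟧' ≫ (shiftFunctorAdd' (DerivedCategory A) n 1 m hm).inv.app _ := by
  -- Once `φ` dies on a cover `p`, it factors through the connecting morphism of the kernel sequence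
  -- of `p`.
  obtain ⟨X', p, hp, h⟩ := exists_epi_comp_singleFunctor_eq_zero m hn φ
  have hS : (ShortComplex.mk (kernel.ι p) p (kernel.condition p)).ShortExact :=
    { exact := ShortComplex.exact_of_f_is_kernel _ (kernelIsKernel p) }
  obtain ⟨δ, H⟩ := singleFunctor_isHeartInclusion.ses _ _ _ hS
  obtain ⟨ψ, hψ⟩ := H.desc₃ φ h
  obtain ⟨ψ', hψ'⟩ := (shiftFunctor (DerivedCategory A) (1 : ℤ)).map_surjective
    (ψ ≫ (shiftFunctorAdd' (DerivedCategory A) n 1 m hm).hom.app _)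
  refine ⟨X', _, _, p, _, hS, δ, ψ', H, ?_⟩
  rw [hψ', hψ, assoc, Iso.hom_inv_id_app, comp_id]

/-- In degree two, write `φ` as a product of `δ` and `ψ`. The corresponding product in `T` vanishes,
so the image of `ψ` extends along `k`; transporting this extension back makes `ψ` a pullback along
`k`, which `δ` kills. In higher degrees the factor `ψ` is zero by induction. -/
lemma singleFunctor_hom_eq_zero [HasDerivedCategory.{w} A] (j : A ⥤ T) (hj : IsHeartInclusion j)
    (h : ∀ (X Y : A) (f : j.obj X ⟶ (j.obj Y)⟦(2 : ℤ)⟧), f = 0) (n : ℕ) :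
    ∀ (X Y : A) (m : ℤ) (_ : m = n + 2)
      (φ : (singleFunctor A 0).obj X ⟶ ((singleFunctor A 0).obj Y)⟦m⟧), φ = 0 := by
  have hi : IsHeartInclusion (singleFunctor A 0) := singleFunctor_isHeartInclusion
  induction n with
  | zero =>
    intro X Y m hm φ
    obtain ⟨X', K, k, p, w, hS, δ, ψ, H, rfl⟩ :=
      exists_singleFunctor_factorization 1 m (by lia) (by lia) φ
    obtain ⟨δ', H'⟩ := hj.ses _ _ _ hS
    obtain ⟨ψ', hψ'⟩ := ExtRel.exists_right hi hj ψ
    obtain ⟨χ', hχ'⟩ := H'.desc₁ ψ' (by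
      rw [← cancel_mono ((shiftFunctorAdd' T 1 1 2 rfl).inv.app _), zero_comp]
      exact h _ _ _)
    obtain ⟨χ, hχ⟩ := ExtRel.exists_left hi hj χ'
    have hχ₂ := ExtRel.comp_left hi hj hχ k
    rw [← hχ'] at hχ₂
    have h0 := H.comp₃₁
    rw [ExtRel.left_unique hi hj hψ' hχ₂, Functor.map_comp, assoc, reassoc_of% h0, zero_comp]
  | succ n hn =>
    intro X Y m hm φ
    obtain ⟨X', K, k, p, w, hS, δ, ψ, H, rfl⟩ :=
      exists_singleFunctor_factorization (m - 1) m (by lia) (by lia) φ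
    rw [hn K Y (m - 1) (by push_cast at hm; lia) ψ, Functor.map_zero, zero_comp, comp_zero]

lemma isHereditary_iff_singleFunctor [HasDerivedCategory.{w} A] :
    IsHereditary A ↔ ∀ (X Y : A) (n : ℕ) (_ : 2 ≤ n)
      (φ : (singleFunctor A 0).obj X ⟶ ((singleFunctor A 0).obj Y)⟦(n : ℤ)⟧), φ = 0 := by
  let := HasExt.standard A
  constructor
  · intro h X Y n hn φ
    have := HasProjectiveDimensionLT.subsingleton X 2 (hX := h X) n hn Y
    have := (Abelian.Ext.homEquiv (X := X) (Y := Y) (n := n)).symm.subsingleton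
    exact Subsingleton.elim (α := ShiftedHom _ _ _) _ _
  · intro h X
    refine .mk (fun n hn Y e => ?_)
    apply Abelian.Ext.homEquiv.injective
    exact (h X Y n hn _).trans (h X Y n hn _).symm

/-- If an abelian category embeds as a heart with vanishing second extensions, then it is
hereditary. -/
lemma IsHeartInclusion.isHereditary (j : A ⥤ T) (hj : IsHeartInclusion j)
    (h : ∀ (X Y : A) (f : j.obj X ⟶ (j.obj Y)⟦(2 : ℤ)⟧), f = 0) : IsHereditary A := by
  let := HasDerivedCategory.standard A
  rw [isHereditary_iff_singleFunctor]
  intro X Y n hn φ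
  exact singleFunctor_hom_eq_zero j hj h (n - 2) X Y n (by lia) φ

end Hereditary

/-! ### The bounded derived category and its standard t-structure. -/

section Db

open DerivedCategory

variable (A : Type u) [Category.{v} A] [Abelian A]

/-- The canonical t-structure on the bounded derived category. -/
noncomputable def Db.t : TStructure (Db A) :=
  letI : HasDerivedCategory.{max u v} A := HasDerivedCategory.standard A
  (TStructure.t (C := A)).onBounded

noncomputable instance : CategoryTheory.IsTriangulated (Db A) := by
  unfold Db
  let : HasDerivedCategory.{max u v} A := HasDerivedCategory.standard A
  infer_instance

instance : (Db.single A).Full :=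
  let : HasDerivedCategory.{max u v} A := HasDerivedCategory.standard A
  .of_comp_faithful_iso (G := (TStructure.t (C := A)).bounded.ι)
    ((TStructure.t (C := A)).bounded.liftCompιIso (singleFunctor A 0) _)

instance : (Db.single A).Faithful :=
  let : HasDerivedCategory.{max u v} A := HasDerivedCategory.standard A
  .of_comp_iso (G := (TStructure.t (C := A)).bounded.ι)
    ((TStructure.t (C := A)).bounded.liftCompιIso (singleFunctor A 0) _)

instance : (Db.single A).Additive where
  map_add {X Y f g} := by
    let : HasDerivedCategory.{max u v} A := HasDerivedCategory.standard A
    apply (TStructure.t (C := A)).bounded.ι.map_injective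
    exact (singleFunctor A 0).map_add

lemma Db.isBounded : IsBounded (Db.t A) := by
  let : HasDerivedCategory.{max u v} A := HasDerivedCategory.standard A
  rintro ⟨X, ⟨a, ha⟩, ⟨b, hb⟩⟩
  refine ⟨max a.natAbs b.natAbs, ?_, ?_⟩
  · exact (TStructure.t (C := A)).ge_antitone (by lia) _ ha.ge
  · exact (TStructure.t (C := A)).le_monotone (by lia) _ hb.le

lemma Db.heart_iff (X : Db A) : (Db.t A).heart X ↔ (Db.single A).essImage X := by
  let : HasDerivedCategory.{max u v} A := HasDerivedCategory.standard A
  have h := singleFunctor_heart X.obj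
  constructor
  · intro hX
    obtain ⟨Y, ⟨e⟩⟩ := h.1 hX
    exact ⟨Y, ⟨(Bounded.ι (C := A)).preimageIso e⟩⟩
  · rintro ⟨Y, ⟨e⟩⟩
    exact h.2 ⟨Y, ⟨(Bounded.ι (C := A)).mapIso e⟩⟩

lemma Db.single_isHeartInclusion : IsHeartInclusion (Db.single A) :=
  .of_heart (Db.t A) _ (Db.heart_iff A)

lemma Db.single_hom_eq_zero (hA : IsHereditary A) (X Y : A) (n : ℕ) (hn : 2 ≤ n)
    (f : (Db.single A).obj X ⟶ ((Db.single A).obj Y)⟦(n : ℤ)⟧) : f = 0 := by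
  let : HasDerivedCategory.{max u v} A := HasDerivedCategory.standard A
  rw [isHereditary_iff_singleFunctor] at hA
  apply (Bounded.ι (C := A)).map_injective
  rw [← cancel_mono (((Bounded.ι (C := A)).commShiftIso (n : ℤ)).hom.app _),
    Functor.map_zero, zero_comp]
  exact hA X Y n hn _

lemma Db.homGap (hA : IsHereditary A) : HomGap (Db.t A) := by
  refine homGap_of_heart (Db.isBounded A) (fun X Y hX hY n hn f => ?_)
  obtain ⟨X', ⟨eX⟩⟩ := (Db.heart_iff A X).1 hX
  obtain ⟨Y', ⟨eY⟩⟩ := (Db.heart_iff A Y).1 hY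
  obtain ⟨m, rfl⟩ := Int.eq_ofNat_of_zero_le (show 0 ≤ n by lia)
  rw [← cancel_epi eX.hom, ← cancel_mono (eY.inv⟦(m : ℤ)⟧'), comp_zero, zero_comp]
  exact Db.single_hom_eq_zero A hA _ _ m (by lia) _

end Db

/-! ### Coherence identities for shifts. -/

section

variable {C : Type u} [Category.{v} C] [HasShift C ℤ]

lemma shiftFunctor_obj_congr (X : C) {n m : ℤ} (h : n = m) : X⟦n⟧ = X⟦m⟧ := by rw [h]

lemma shiftFunctorAdd'_inv_app_map {X Y : C} (f : X ⟶ Y) (a n m : ℤ) (h : a + n = m) :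
    (shiftFunctorAdd' C a n m h).inv.app X ≫ f⟦m⟧' =
      f⟦a⟧'⟦n⟧' ≫ (shiftFunctorAdd' C a n m h).inv.app Y :=
  ((shiftFunctorAdd' C a n m h).inv.naturality f).symm

lemma shiftFunctorAdd_hom_app_map {X Y : C} (f : X ⟶ Y) (n k : ℤ) :
    (shiftFunctorAdd C n k).hom.app X ≫ f⟦n⟧'⟦k⟧' =
      f⟦n + k⟧' ≫ (shiftFunctorAdd C n k).hom.app Y :=
  ((shiftFunctorAdd C n k).hom.naturality f).symm

lemma shiftFunctorAdd_conj_map {X Y : C} (f : X ⟶ Y) (n k : ℤ) :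
    (shiftFunctorAdd C n k).hom.app X ≫ f⟦n⟧'⟦k⟧' ≫ (shiftFunctorAdd C n k).inv.app Y =
      f⟦n + k⟧' := by
  rw [← assoc, shiftFunctorAdd_hom_app_map, assoc, Iso.hom_inv_id_app, comp_id]

lemma shiftFunctorAdd_conj_map_comp {X Y : C} (a n m k : ℤ) (h : a + n = m)
    (h' : a + (n + k) = m + k) (e : X ⟶ Y⟦a⟧) :
    (shiftFunctorAdd C n k).hom.app X ≫
      (e⟦n⟧' ≫ (shiftFunctorAdd' C a n m h).inv.app Y)⟦k⟧' ≫
        (shiftFunctorAdd C m k).inv.app Y =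
      e⟦n + k⟧' ≫ (shiftFunctorAdd' C a (n + k) (m + k) h').inv.app Y := by
  have := shiftFunctorAdd'_assoc_inv_app a n k m (n + k) (m + k) h rfl (by lia) Y
  rw [shiftFunctorAdd'_eq_shiftFunctorAdd, shiftFunctorAdd'_eq_shiftFunctorAdd] at this
  rw [Functor.map_comp, assoc, this, ← assoc, ← assoc]
  congr 1
  rw [assoc]
  exact shiftFunctorAdd_conj_map e n k

end

/-! ### Corresponding morphisms between shifts of heart objects. -/

section ShiftRel

variable {A : Type u'} [Category.{v'} A] [Abelian A]
  {D : Type u} [Category.{v} D] [Preadditive D] [HasZeroObject D] [HasShift D ℤ]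
  [∀ n : ℤ, (shiftFunctor D n).Additive] [Pretriangulated D]
  {T : Type w} [Category.{w'} T] [Preadditive T] [HasZeroObject T] [HasShift T ℤ]
  [∀ n : ℤ, (shiftFunctor T n).Additive] [Pretriangulated T]
  {i : A ⥤ D} {j : A ⥤ T}

variable (i j) in
/-- The morphisms `f` and `g` between shifts of objects of the two hearts correspond to each
other: they come from the same morphism or from the same short exact sequence. -/
structure ShiftRel {X Y : A} {n m : ℤ} (f : (i.obj X)⟦n⟧ ⟶ (i.obj Y)⟦m⟧)
    (g : (j.obj X)⟦n⟧ ⟶ (j.obj Y)⟦m⟧) : Prop where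
  of_eq (h : n = m) : ∃ u : X ⟶ Y,
    f = (i.map u)⟦n⟧' ≫ eqToHom (shiftFunctor_obj_congr _ h) ∧
    g = (j.map u)⟦n⟧' ≫ eqToHom (shiftFunctor_obj_congr _ h)
  of_add_eq (h : 1 + n = m) : ∃ e e', ExtRel i j e e' ∧
    f = e⟦n⟧' ≫ (shiftFunctorAdd' D 1 n m h).inv.app (i.obj Y) ∧
    g = e'⟦n⟧' ≫ (shiftFunctorAdd' T 1 n m h).inv.app (j.obj Y)

/-- The functor `i` is the inclusion of a heart without extensions of degree at least two. -/
structure IsHereditaryHeartInclusion (i : A ⥤ D) : Prop extends IsHeartInclusion i where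
  hom_two ⦃X Y : A⦄ ⦃n : ℤ⦄ (f : i.obj X ⟶ (i.obj Y)⟦n⟧) (hn : 2 ≤ n) : f = 0

/-- In these degrees `ShiftRel` imposes no condition; this vanishing is what still makes it the
graph of a bijection. -/
lemma IsHereditaryHeartInclusion.hom_shift (hi : IsHereditaryHeartInclusion i) {X Y : A} {n m : ℤ}
    (f : (i.obj X)⟦n⟧ ⟶ (i.obj Y)⟦m⟧) (h₀ : n ≠ m) (h₁ : 1 + n ≠ m) : f = 0 := by
  refine hom_eq_zero_of_shift_left n m (m - n) (by lia) (fun g => ?_) f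
  by_cases h : m - n < 0
  · exact hi.hom_neg g h
  · exact hi.hom_two g (by lia)

namespace ShiftRel

lemma symm {X Y : A} {n m : ℤ} {f : (i.obj X)⟦n⟧ ⟶ (i.obj Y)⟦m⟧}
    {g : (j.obj X)⟦n⟧ ⟶ (j.obj Y)⟦m⟧} (h : ShiftRel i j f g) : ShiftRel j i g f where
  of_eq h' := by
    obtain ⟨u, h₁, h₂⟩ := h.of_eq h'
    exact ⟨u, h₂, h₁⟩
  of_add_eq h' := by
    obtain ⟨e, e', h, h₁, h₂⟩ := h.of_add_eq h'
    exact ⟨e', e, h.symm, h₂, h₁⟩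

lemma map {X Y : A} (u : X ⟶ Y) {n m : ℤ} (h : n = m) :
    ShiftRel i j ((i.map u)⟦n⟧' ≫ eqToHom (shiftFunctor_obj_congr _ h))
      ((j.map u)⟦n⟧' ≫ eqToHom (shiftFunctor_obj_congr _ h)) where
  of_eq _ := ⟨u, rfl, rfl⟩
  of_add_eq h' := by lia

lemma eqToHom (X : A) {n m : ℤ} (h : n = m) :
    ShiftRel i j (eqToHom (shiftFunctor_obj_congr (i.obj X) h))
      (eqToHom (shiftFunctor_obj_congr (j.obj X) h)) := by
  simpa using map (i := i) (j := j) (𝟙 X) h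

lemma of_extRel {X Y : A} {e : i.obj X ⟶ (i.obj Y)⟦(1 : ℤ)⟧}
    {e' : j.obj X ⟶ (j.obj Y)⟦(1 : ℤ)⟧} (h : ExtRel i j e e') {n m : ℤ} (hm : 1 + n = m) :
    ShiftRel i j (e⟦n⟧' ≫ (shiftFunctorAdd' D 1 n m hm).inv.app (i.obj Y))
      (e'⟦n⟧' ≫ (shiftFunctorAdd' T 1 n m hm).inv.app (j.obj Y)) where
  of_eq _ := by lia
  of_add_eq _ := ⟨e, e', h, rfl, rfl⟩

section

variable (hi : IsHeartInclusion i) (hj : IsHeartInclusion j)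
include hi hj

lemma zero (X Y : A) (n m : ℤ) :
    ShiftRel i j (0 : (i.obj X)⟦n⟧ ⟶ (i.obj Y)⟦m⟧) 0 where
  of_eq _ := by
    have := hi.additive
    have := hj.additive
    exact ⟨0, by simp, by simp⟩
  of_add_eq _ := ⟨0, 0, ExtRel.zero hi hj X Y, by simp, by simp⟩

lemma add {X Y : A} {n m : ℤ} {f f' : (i.obj X)⟦n⟧ ⟶ (i.obj Y)⟦m⟧}
    {g g' : (j.obj X)⟦n⟧ ⟶ (j.obj Y)⟦m⟧} (h : ShiftRel i j f g) (h' : ShiftRel i j f' g') :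
    ShiftRel i j (f + f') (g + g') where
  of_eq h₀ := by
    have := hi.additive
    have := hj.additive
    obtain ⟨u, rfl, rfl⟩ := h.of_eq h₀
    obtain ⟨u', rfl, rfl⟩ := h'.of_eq h₀
    exact ⟨u + u', by simp, by simp⟩
  of_add_eq h₁ := by
    obtain ⟨e₁, e₁', h₂, rfl, rfl⟩ := h.of_add_eq h₁
    obtain ⟨e₂, e₂', h₃, rfl, rfl⟩ := h'.of_add_eq h₁
    exact ⟨_, _, h₂.add hi hj h₃, by simp, by simp⟩

lemma sum {X Y : A} {n m : ℤ} {J : Type*} (s : Finset J) (f : J → ((i.obj X)⟦n⟧ ⟶ (i.obj Y)⟦m⟧))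
    (g : J → ((j.obj X)⟦n⟧ ⟶ (j.obj Y)⟦m⟧)) (h : ∀ a, ShiftRel i j (f a) (g a)) :
    ShiftRel i j (∑ a ∈ s, f a) (∑ a ∈ s, g a) := by
  classical
  induction s using Finset.induction_on with
  | empty => simpa using zero hi hj X Y n m
  | insert a s ha hs =>
    rw [Finset.sum_insert ha, Finset.sum_insert ha]
    exact add hi hj (h a) hs

end

lemma exists_right (hi : IsHeartInclusion i) (hj : IsHeartInclusion j) {X Y : A} {n m : ℤ}
    (f : (i.obj X)⟦n⟧ ⟶ (i.obj Y)⟦m⟧) : ∃ g, ShiftRel i j f g := by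
  have := hi.full
  by_cases h₀ : n = m
  · subst h₀
    obtain ⟨u, rfl⟩ := (i ⋙ shiftFunctor D n).map_surjective f
    exact ⟨(j.map u)⟦n⟧', by simpa using map u rfl⟩
  by_cases h₁ : 1 + n = m
  · obtain ⟨e, he⟩ := (shiftFunctor D n).map_surjective
      (f ≫ (shiftFunctorAdd' D 1 n m h₁).hom.app (i.obj Y))
    obtain ⟨e', h⟩ := ExtRel.exists_right hi hj e
    refine ⟨e'⟦n⟧' ≫ (shiftFunctorAdd' T 1 n m h₁).inv.app (j.obj Y), ?_⟩
    simpa [he] using of_extRel h h₁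
  · exact ⟨0, fun h => (h₀ h).elim, fun h => (h₁ h).elim⟩

section

variable (hi : IsHereditaryHeartInclusion i) (hj : IsHereditaryHeartInclusion j)
include hi hj

lemma right_unique {X Y : A} {n m : ℤ} {f : (i.obj X)⟦n⟧ ⟶ (i.obj Y)⟦m⟧}
    {g g' : (j.obj X)⟦n⟧ ⟶ (j.obj Y)⟦m⟧} (h : ShiftRel i j f g) (h' : ShiftRel i j f g') :
    g = g' := by
  have := hi.faithful
  by_cases h₀ : n = m
  · subst h₀
    obtain ⟨u, rfl, rfl⟩ := h.of_eq rfl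
    obtain ⟨u', hu, rfl⟩ := h'.of_eq rfl
    simp only [eqToHom_refl, comp_id] at hu
    obtain rfl := (i ⋙ shiftFunctor D n).map_injective hu
    rfl
  by_cases h₁ : 1 + n = m
  · obtain ⟨e, e', H, rfl, rfl⟩ := h.of_add_eq h₁
    obtain ⟨e₂, e₂', H', he, rfl⟩ := h'.of_add_eq h₁
    rw [cancel_mono] at he
    obtain rfl := (shiftFunctor D n).map_injective he
    rw [ExtRel.right_unique hi.toIsHeartInclusion hj.toIsHeartInclusion H H']
  · rw [hj.hom_shift g h₀ h₁, hj.hom_shift g' h₀ h₁]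

lemma comp {X Y Z : A} {n m l : ℤ} {f : (i.obj X)⟦n⟧ ⟶ (i.obj Y)⟦m⟧}
    {g : (j.obj X)⟦n⟧ ⟶ (j.obj Y)⟦m⟧} (h : ShiftRel i j f g)
    {f' : (i.obj Y)⟦m⟧ ⟶ (i.obj Z)⟦l⟧} {g' : (j.obj Y)⟦m⟧ ⟶ (j.obj Z)⟦l⟧}
    (h' : ShiftRel i j f' g') : ShiftRel i j (f ≫ f') (g ≫ g') := by
  have hi' := hi.toIsHeartInclusion
  have hj' := hj.toIsHeartInclusion
  by_cases h₀ : n = m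
  · subst h₀
    obtain ⟨u, rfl, rfl⟩ := h.of_eq rfl
    refine ⟨fun hl => ?_, fun hl => ?_⟩
    · subst hl
      obtain ⟨u', rfl, rfl⟩ := h'.of_eq rfl
      exact ⟨u ≫ u', by simp, by simp⟩
    · obtain ⟨e, e', H, rfl, rfl⟩ := h'.of_add_eq hl
      exact ⟨_, _, H.comp_left hi' hj' u, by simp, by simp⟩
  by_cases h₁ : 1 + n = m
  · obtain ⟨e, e', H, rfl, rfl⟩ := h.of_add_eq h₁
    by_cases h₂ : m = l
    · subst h₂
      obtain ⟨u', rfl, rfl⟩ := h'.of_eq rfl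
      have := of_extRel (H.comp_right hi' hj' u') h₁
      simpa [shiftFunctorAdd'_inv_app_map] using this
    · by_cases h₃ : 1 + m = l
      -- A product of two extension classes has degree two, where the relation is vacuous.
      · exact ⟨fun h => by lia, fun h => by lia⟩
      · rw [hi.hom_shift f' h₂ h₃, hj.hom_shift g' h₂ h₃, comp_zero, comp_zero]
        exact zero hi' hj' _ _ _ _
  · rw [hi.hom_shift f h₀ h₁, hj.hom_shift g h₀ h₁, zero_comp, zero_comp]
    exact zero hi' hj' _ _ _ _

end

lemma shift {X Y : A} {n m : ℤ} {f : (i.obj X)⟦n⟧ ⟶ (i.obj Y)⟦m⟧}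
    {g : (j.obj X)⟦n⟧ ⟶ (j.obj Y)⟦m⟧} (h : ShiftRel i j f g) (k : ℤ) :
    ShiftRel i j ((shiftFunctorAdd D n k).hom.app _ ≫ f⟦k⟧' ≫ (shiftFunctorAdd D m k).inv.app _)
      ((shiftFunctorAdd T n k).hom.app _ ≫ g⟦k⟧' ≫ (shiftFunctorAdd T m k).inv.app _) where
  of_eq h₀ := by
    obtain rfl : n = m := by lia
    obtain ⟨u, rfl, rfl⟩ := h.of_eq rfl
    exact ⟨u, by simp [shiftFunctorAdd_conj_map], by simp [shiftFunctorAdd_conj_map]⟩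
  of_add_eq h₁ := by
    obtain ⟨e, e', H, rfl, rfl⟩ := h.of_add_eq (by lia)
    exact ⟨e, e', H, shiftFunctorAdd_conj_map_comp _ _ _ _ _ _ _,
      shiftFunctorAdd_conj_map_comp _ _ _ _ _ _ _⟩

end ShiftRel

end ShiftRel

/-! ### Conjugating shifted morphisms by the shift isomorphisms. -/

section

variable {C : Type u} [Category.{v} C] [HasShift C ℤ]

lemma shiftFunctorAdd_zero_hom_app_comp (X : C) (n : ℤ) :
    (shiftFunctorAdd C n 0).hom.app X ≫ (shiftFunctorZero C ℤ).hom.app (X⟦n⟧) =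
      eqToHom (shiftFunctor_obj_congr X (add_zero n)) := by
  rw [shiftFunctorAdd_add_zero_hom_app, assoc, Iso.inv_hom_id_app]
  exact comp_id _

lemma shiftFunctorAdd_add_hom_app_comp (X : C) (n k l : ℤ) :
    (shiftFunctorAdd C n (k + l)).hom.app X ≫ (shiftFunctorAdd C k l).hom.app (X⟦n⟧) ≫
      ((shiftFunctorAdd C n k).inv.app X)⟦l⟧' ≫ (shiftFunctorAdd C (n + k) l).inv.app X =
      eqToHom (shiftFunctor_obj_congr X (add_assoc n k l).symm) := by
  rw [shiftFunctorAdd_assoc_inv_app, Iso.hom_inv_id_app_assoc]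
  simp [shiftFunctorAdd']

section

variable {X Y U U' : C} {n m : ℤ} (a : X⟦n⟧ ⟶ U) (f : U ⟶ U') (b : U' ⟶ Y⟦m⟧)

lemma shiftFunctorAdd_conj_comp (k : ℤ) :
    ((shiftFunctorAdd C n k).hom.app X ≫ a⟦k⟧') ≫ f⟦k⟧' ≫
      b⟦k⟧' ≫ (shiftFunctorAdd C m k).inv.app Y =
    (shiftFunctorAdd C n k).hom.app X ≫ (a ≫ f ≫ b)⟦k⟧' ≫ (shiftFunctorAdd C m k).inv.app Y := by
  simp only [Functor.map_comp, assoc]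

lemma shiftFunctorZero_conj_comp (b : U ⟶ Y⟦m⟧) :
    ((shiftFunctorAdd C n 0).hom.app X ≫ a⟦(0 : ℤ)⟧') ≫ (shiftFunctorZero C ℤ).hom.app U ≫ b =
      eqToHom (shiftFunctor_obj_congr X (add_zero n)) ≫ a ≫ 𝟙 U ≫ b := by
  have h := (shiftFunctorZero C ℤ).hom.naturality a
  simp only [Functor.id_map, Functor.id_obj] at h
  rw [← shiftFunctorAdd_zero_hom_app_comp, assoc, assoc, reassoc_of% h, id_comp]

lemma shiftFunctorAdd_conj_add (b : U ⟶ Y⟦m⟧) (k l : ℤ) :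
    ((shiftFunctorAdd C n (k + l)).hom.app X ≫ a⟦k + l⟧') ≫ (shiftFunctorAdd C k l).hom.app U ≫
      (b⟦k⟧' ≫ (shiftFunctorAdd C m k).inv.app Y)⟦l⟧' ≫
        (shiftFunctorAdd C (m + k) l).inv.app Y =
    ((shiftFunctorAdd C n (k + l)).hom.app X ≫ (a ≫ 𝟙 U ≫ b)⟦k + l⟧' ≫
      (shiftFunctorAdd C m (k + l)).inv.app Y) ≫
        eqToHom (shiftFunctor_obj_congr Y (add_assoc m k l).symm) := by
  have h := (shiftFunctorAdd C k l).hom.naturality b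
  simp only [Functor.comp_map, Functor.comp_obj] at h
  rw [← shiftFunctorAdd_add_hom_app_comp]
  simp only [Functor.map_comp, assoc, id_comp, Iso.inv_hom_id_app_assoc]
  rw [reassoc_of% h]

end

end

/-! ### Pairs of objects with a common decomposition. -/

section Matched

variable {A : Type u'} [Category.{v'} A] [Abelian A]
  {D : Type u} [Category.{v} D] [Preadditive D] [HasZeroObject D] [HasShift D ℤ]
  [∀ n : ℤ, (shiftFunctor D n).Additive] [Pretriangulated D]
  {T : Type w} [Category.{w'} T] [Preadditive T] [HasZeroObject T] [HasShift T ℤ]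
  [∀ n : ℤ, (shiftFunctor T n).Additive] [Pretriangulated T]

/-- A pair of objects of the two categories which are decomposed in the same way into shifts of
objects of the hearts. -/
structure Matched (i : A ⥤ D) (j : A ⥤ T) where
  /-- the object of the first category -/
  fst : D
  /-- the object of the second category -/
  snd : T
  /-- the index set of the summands -/
  J : Type
  [fintype : Fintype J]
  /-- the objects of the heart which appear as summands -/
  obj : J → A
  /-- the degrees of the summands -/
  deg : J → ℤ
  /-- the decomposition of the first object -/
  decomp₁ : Decomp fst (fun a => (i.obj (obj a))⟦deg a⟧)
  /-- the decomposition of the second object -/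
  decomp₂ : Decomp snd (fun a => (j.obj (obj a))⟦deg a⟧)

namespace Matched

attribute [instance] fintype

variable {i : A ⥤ D} {j : A ⥤ T}

/-- The pairs of morphisms all of whose components correspond to each other. -/
def HomRel (r s : Matched i j) (f : r.fst ⟶ s.fst) (g : r.snd ⟶ s.snd) : Prop :=
  ∀ a b, ShiftRel i j (r.decomp₁.ι a ≫ f ≫ s.decomp₁.π b) (r.decomp₂.ι a ≫ g ≫ s.decomp₂.π b)

/-- Morphisms of matched pairs. -/
@[ext]
structure Hom (r s : Matched i j) where
  /-- the morphism in the first category -/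
  fst : r.fst ⟶ s.fst
  /-- the morphism in the second category -/
  snd : r.snd ⟶ s.snd
  rel : HomRel r s fst snd

lemma _root_.HereditaryDerived.Decomp.exists_of_matrix {C : Type*} [Category* C] [Preadditive C]
    {X X' : C} {J J' : Type} [Fintype J] [Fintype J'] {Y : J → C} {Y' : J' → C} (d : Decomp X Y)
    (d' : Decomp X' Y') (m : ∀ a b, Y a ⟶ Y' b) :
    ∃ f : X ⟶ X', ∀ a b, d.ι a ≫ f ≫ d'.π b = m a b := by
  classical
  refine ⟨∑ a, ∑ b, d.π a ≫ m a b ≫ d'.ι b, fun a b => ?_⟩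
  simp only [Preadditive.sum_comp, Preadditive.comp_sum, assoc]
  rw [Finset.sum_eq_single a, Finset.sum_eq_single b]
  · rw [d'.ι_π_self, comp_id, ← assoc, d.ι_π_self, id_comp]
  · intro b' _ hb
    rw [d'.ι_π_ne b' b hb, comp_zero, comp_zero, comp_zero]
  · simp
  · intro a' _ ha
    refine Finset.sum_eq_zero (fun b' _ => ?_)
    rw [← assoc (d.ι a), d.ι_π_ne a a' ha.symm, zero_comp]
  · simp

section

variable (hi : IsHeartInclusion i) (hj : IsHeartInclusion j)
include hi hj

lemma HomRel.exists_right (r s : Matched i j) (f : r.fst ⟶ s.fst) : ∃ g, HomRel r s f g := by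
  choose m hm using fun a b => ShiftRel.exists_right hi hj (r.decomp₁.ι a ≫ f ≫ s.decomp₁.π b)
  obtain ⟨g, hg⟩ := Decomp.exists_of_matrix r.decomp₂ s.decomp₂ m
  exact ⟨g, fun a b => by rw [hg]; exact hm a b⟩

lemma HomRel.exists_left (r s : Matched i j) (g : r.snd ⟶ s.snd) : ∃ f, HomRel r s f g := by
  choose m hm using fun a b => ShiftRel.exists_right hj hi (r.decomp₂.ι a ≫ g ≫ s.decomp₂.π b)
  obtain ⟨f, hf⟩ := Decomp.exists_of_matrix r.decomp₁ s.decomp₁ m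
  exact ⟨f, fun a b => by rw [hf]; exact (hm a b).symm⟩

lemma HomRel.id (r : Matched i j) : HomRel r r (𝟙 _) (𝟙 _) := by
  intro a b
  rw [id_comp, id_comp]
  by_cases h : a = b
  · subst h
    simpa using ShiftRel.eqToHom (i := i) (j := j) (r.obj a) (rfl : r.deg a = r.deg a)
  · rw [r.decomp₁.ι_π_ne a b h, r.decomp₂.ι_π_ne a b h]
    exact ShiftRel.zero hi hj _ _ _ _

end

section

variable (hi : IsHereditaryHeartInclusion i) (hj : IsHereditaryHeartInclusion j)
include hi hj

lemma HomRel.right_unique {r s : Matched i j} {f : r.fst ⟶ s.fst} {g g' : r.snd ⟶ s.snd}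
    (h : HomRel r s f g) (h' : HomRel r s f g') : g = g' :=
  r.decomp₂.hom_ext' (fun a => s.decomp₂.hom_ext (fun b => by
    simpa only [assoc] using ShiftRel.right_unique hi hj (h a b) (h' a b)))

lemma HomRel.left_unique {r s : Matched i j} {f f' : r.fst ⟶ s.fst} {g : r.snd ⟶ s.snd}
    (h : HomRel r s f g) (h' : HomRel r s f' g) : f = f' :=
  r.decomp₁.hom_ext' (fun a => s.decomp₁.hom_ext (fun b => by
    simpa only [assoc] using ShiftRel.right_unique hj hi (h a b).symm (h' a b).symm))

lemma HomRel.comp {r s q : Matched i j} {f : r.fst ⟶ s.fst} {g : r.snd ⟶ s.snd}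
    (h : HomRel r s f g) {f' : s.fst ⟶ q.fst} {g' : s.snd ⟶ q.snd} (h' : HomRel s q f' g') :
    HomRel r q (f ≫ f') (g ≫ g') := by
  intro a c
  have key := ShiftRel.sum hi.toIsHeartInclusion hj.toIsHeartInclusion Finset.univ _ _
    (fun b => ShiftRel.comp hi hj (h a b) (h' b c))
  convert key using 1
  · conv_lhs => rw [← id_comp f', ← s.decomp₁.total]
    simp only [Preadditive.sum_comp, Preadditive.comp_sum, assoc]
  · conv_lhs => rw [← id_comp g', ← s.decomp₂.total]
    simp only [Preadditive.sum_comp, Preadditive.comp_sum, assoc]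

end

end Matched

/-- The shift of a decomposition into shifted objects. -/
def Decomp.shift {U : D} {J : Type} [Fintype J] {X : J → D} {n : J → ℤ}
    (d : Decomp U (fun a => (X a)⟦n a⟧)) (k : ℤ) :
    Decomp (U⟦k⟧) (fun a => (X a)⟦n a + k⟧) where
  ι a := (shiftFunctorAdd D (n a) k).hom.app _ ≫ (d.ι a)⟦k⟧'
  π a := (d.π a)⟦k⟧' ≫ (shiftFunctorAdd D (n a) k).inv.app _
  ι_π_self a := by
    rw [assoc, ← Functor.map_comp_assoc, d.ι_π_self, CategoryTheory.Functor.map_id, id_comp,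
      Iso.hom_inv_id_app]
  ι_π_ne a b h := by
    rw [assoc, ← Functor.map_comp_assoc, d.ι_π_ne a b h, Functor.map_zero, zero_comp, comp_zero]
  total := by
    simp only [assoc, Iso.inv_hom_id_app_assoc, ← Functor.map_comp]
    rw [← Functor.map_sum, d.total, CategoryTheory.Functor.map_id]

namespace Matched

variable {i : A ⥤ D} {j : A ⥤ T}

/-- The shift of a matched pair. -/
def shiftObj (r : Matched i j) (k : ℤ) : Matched i j where
  fst := r.fst⟦k⟧
  snd := r.snd⟦k⟧
  J := r.J
  obj := r.obj
  deg a := r.deg a + k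
  decomp₁ := r.decomp₁.shift k
  decomp₂ := r.decomp₂.shift k

lemma HomRel.shift {r s : Matched i j} {f : r.fst ⟶ s.fst} {g : r.snd ⟶ s.snd}
    (h : HomRel r s f g) (k : ℤ) : HomRel (r.shiftObj k) (s.shiftObj k) (f⟦k⟧') (g⟦k⟧') := by
  intro a b
  have := (h a b).shift k
  rw [← shiftFunctorAdd_conj_comp, ← shiftFunctorAdd_conj_comp] at this
  exact this

section

variable (hi : IsHereditaryHeartInclusion i) (hj : IsHereditaryHeartInclusion j)
include hi hj

lemma HomRel.shiftZero (r : Matched i j) :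
    HomRel (r.shiftObj 0) r ((shiftFunctorZero D ℤ).hom.app r.fst)
      ((shiftFunctorZero T ℤ).hom.app r.snd) := by
  intro a b
  have h₁ := HomRel.id hi.toIsHeartInclusion hj.toIsHeartInclusion r a b
  have h₂ := ShiftRel.eqToHom (i := i) (j := j) (r.obj a) (add_zero (r.deg a))
  have := ShiftRel.comp hi hj h₂ h₁
  rw [← shiftFunctorZero_conj_comp, ← shiftFunctorZero_conj_comp] at this
  exact this

lemma HomRel.shiftAdd (r : Matched i j) (k l : ℤ) :
    HomRel (r.shiftObj (k + l)) ((r.shiftObj k).shiftObj l)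
      ((shiftFunctorAdd D k l).hom.app r.fst) ((shiftFunctorAdd T k l).hom.app r.snd) := by
  intro a b
  have h₁ := ShiftRel.shift (HomRel.id hi.toIsHeartInclusion hj.toIsHeartInclusion r a b) (k + l)
  have h₂ := ShiftRel.eqToHom (i := i) (j := j) (r.obj b) (add_assoc (r.deg b) k l).symm
  have := ShiftRel.comp hi hj h₁ h₂
  rw [← shiftFunctorAdd_conj_add, ← shiftFunctorAdd_conj_add] at this
  exact this

end

end Matched

end Matched

section

variable {C : Type*} [Category* C] {X Y : C}

lemma eq_hom_of_id_eq (e : X ≅ Y) (z : X ⟶ Y) (h : 𝟙 X = z ≫ e.inv) : z = e.hom := by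
  rw [← Iso.comp_inv_eq_id, h]

lemma eq_hom_of_id_eq' (e : X ≅ Y) (z : X ⟶ Y) (p : Y ⟶ Y) (hp : p = 𝟙 Y)
    (h : 𝟙 X = z ≫ 𝟙 Y ≫ p ≫ e.inv) : z = e.hom :=
  eq_hom_of_id_eq e z (by simpa [hp] using h)

lemma id_eq_hom_comp (e : X ≅ Y) (p : Y ⟶ Y) (hp : p = 𝟙 Y) :
    𝟙 X = e.hom ≫ 𝟙 Y ≫ p ≫ e.inv := by
  simp [hp]

end

/-! ### The category of matched pairs and its shift. -/

section MatchedCategory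

variable {A : Type u'} [Category.{v'} A] [Abelian A]
  {D : Type u} [Category.{v} D] [Preadditive D] [HasZeroObject D] [HasShift D ℤ]
  [∀ n : ℤ, (shiftFunctor D n).Additive] [Pretriangulated D]
  {T : Type w} [Category.{w'} T] [Preadditive T] [HasZeroObject T] [HasShift T ℤ]
  [∀ n : ℤ, (shiftFunctor T n).Additive] [Pretriangulated T]
  (i : A ⥤ D) (j : A ⥤ T)
  [hi : Fact (IsHereditaryHeartInclusion i)] [hj : Fact (IsHereditaryHeartInclusion j)]

namespace Matched

instance : Category (Matched i j) where
  Hom r s := Hom r s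
  id r := ⟨𝟙 _, 𝟙 _, HomRel.id hi.out.toIsHeartInclusion hj.out.toIsHeartInclusion r⟩
  comp φ ψ := ⟨φ.fst ≫ ψ.fst, φ.snd ≫ ψ.snd, φ.rel.comp hi.out hj.out ψ.rel⟩
  id_comp _ := Hom.ext (id_comp _) (id_comp _)
  comp_id _ := Hom.ext (comp_id _) (comp_id _)
  assoc _ _ _ := Hom.ext (assoc _ _ _) (assoc _ _ _)

/-- The first projection. -/
def toFst : Matched i j ⥤ D where
  obj r := r.fst
  map φ := φ.fst
  map_id _ := rfl
  map_comp _ _ := rfl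

/-- The second projection. -/
def toSnd : Matched i j ⥤ T where
  obj r := r.snd
  map φ := φ.snd
  map_id _ := rfl
  map_comp _ _ := rfl

instance : (toFst i j).Full where
  map_surjective {r s} f := by
    obtain ⟨g, h⟩ := HomRel.exists_right hi.out.toIsHeartInclusion hj.out.toIsHeartInclusion r s f
    exact ⟨⟨f, g, h⟩, rfl⟩

instance : (toSnd i j).Full where
  map_surjective {r s} g := by
    obtain ⟨f, h⟩ := HomRel.exists_left hi.out.toIsHeartInclusion hj.out.toIsHeartInclusion r s g
    exact ⟨⟨f, g, h⟩, rfl⟩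

instance : (toFst i j).Faithful where
  map_injective {r s} φ ψ h := by
    have h' : φ.fst = ψ.fst := h
    exact Hom.ext h' (HomRel.right_unique hi.out hj.out φ.rel (h' ▸ ψ.rel))

instance : (toSnd i j).Faithful where
  map_injective {r s} φ ψ h := by
    have h' : φ.snd = ψ.snd := h
    exact Hom.ext (HomRel.left_unique hi.out hj.out φ.rel (h' ▸ ψ.rel)) h'

/-- The first component determines the second. This identifies the second components of the shift
isomorphisms, which are known only through `toFst`. -/
lemma snd_eq {r s : Matched i j} (φ : r ⟶ s) (f : r.fst ⟶ s.fst) (g : r.snd ⟶ s.snd)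
    (hf : (toFst i j).map φ = f) (h : HomRel r s f g) : (toSnd i j).map φ = g :=
  HomRel.right_unique hi.out hj.out φ.rel (show HomRel r s φ.fst g by
    rw [show φ.fst = f from hf]; exact h)

/-- The shift functors on matched pairs. -/
def shiftFunctor' (k : ℤ) : Matched i j ⥤ Matched i j where
  obj r := r.shiftObj k
  map φ := ⟨φ.fst⟦k⟧', φ.snd⟦k⟧', φ.rel.shift k⟩
  map_id _ := Hom.ext ((shiftFunctor D k).map_id _) ((shiftFunctor T k).map_id _)
  map_comp _ _ := Hom.ext ((shiftFunctor D k).map_comp _ _) ((shiftFunctor T k).map_comp _ _)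

/-- The first projection commutes with the shifts. -/
def shiftIsoFst (k : ℤ) : shiftFunctor' i j k ⋙ toFst i j ≅ toFst i j ⋙ shiftFunctor D k :=
  NatIso.ofComponents (fun _ => Iso.refl _) (fun _ => (comp_id _).trans (id_comp _).symm)

/-- The second projection commutes with the shifts. -/
def shiftIsoSnd (k : ℤ) : shiftFunctor' i j k ⋙ toSnd i j ≅ toSnd i j ⋙ shiftFunctor T k :=
  NatIso.ofComponents (fun _ => Iso.refl _) (fun _ => (comp_id _).trans (id_comp _).symm)

/-- The shift structure is induced along the fully faithful `toFst`, so only compatibility with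
`toSnd` has to be checked by hand. -/
noncomputable instance : HasShift (Matched i j) ℤ :=
  (Functor.FullyFaithful.ofFullyFaithful (toFst i j)).hasShift (shiftFunctor' i j)
    (shiftIsoFst i j)

noncomputable instance : (toFst i j).CommShift ℤ :=
  Functor.CommShift.ofHasShiftOfFullyFaithful
    (Functor.FullyFaithful.ofFullyFaithful (toFst i j)) (shiftFunctor' i j) (shiftIsoFst i j)

lemma toFst_map_shiftFunctorZero (r : Matched i j) :
    (toFst i j).map ((shiftFunctorZero (Matched i j) ℤ).hom.app r) =
      (shiftFunctorZero D ℤ).hom.app r.fst := by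
  have h := NatTrans.congr_app (congr_arg Iso.hom ((toFst i j).commShiftIso_zero ℤ)) r
  rw [Functor.CommShift.isoZero_hom_app] at h
  exact eq_hom_of_id_eq ((shiftFunctorZero D ℤ).app r.fst) _ h

lemma toFst_map_shiftFunctorAdd (r : Matched i j) (k l : ℤ) :
    (toFst i j).map ((shiftFunctorAdd (Matched i j) k l).hom.app r) =
      (shiftFunctorAdd D k l).hom.app r.fst := by
  have h := NatTrans.congr_app (congr_arg Iso.hom ((toFst i j).commShiftIso_add k l)) r
  rw [Functor.CommShift.isoAdd_hom_app] at h
  exact eq_hom_of_id_eq' ((shiftFunctorAdd D k l).app r.fst) _ ((shiftFunctor D l).map (𝟙 _))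
    (CategoryTheory.Functor.map_id _ _) h

noncomputable instance : (toSnd i j).CommShift ℤ where
  commShiftIso := shiftIsoSnd i j
  commShiftIso_zero := by
    ext r
    have := snd_eq i j _ _ _ (toFst_map_shiftFunctorZero i j r) (HomRel.shiftZero hi.out hj.out r)
    rw [Functor.CommShift.isoZero_hom_app, this]
    exact (Iso.hom_inv_id_app (shiftFunctorZero T ℤ) r.snd).symm
  commShiftIso_add k l := by
    ext r
    have := snd_eq i j _ _ _ (toFst_map_shiftFunctorAdd i j r k l)
      (HomRel.shiftAdd hi.out hj.out r k l)
    rw [Functor.CommShift.isoAdd_hom_app, this]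
    exact id_eq_hom_comp ((shiftFunctorAdd T k l).app r.snd) ((shiftFunctor T l).map (𝟙 _))
      (CategoryTheory.Functor.map_id _ _)

end Matched

end MatchedCategory

/-! ### Construction of the triangle equivalence. -/

section

variable {M : Type*} [Category* M] [HasShift M ℤ] {D : Type*} [Category* D] [HasShift D ℤ]
  {T : Type*} [Category* T] [HasShift T ℤ]

/-- A functor commuting with shifts factors through an equivalence commuting with shifts. -/
lemma exists_factorization (E : M ≌ D) [E.functor.CommShift ℤ] (Q : M ⥤ T) [Q.CommShift ℤ] :
    ∃ (F : D ⥤ T) (_ : F.CommShift ℤ) (η : E.functor ⋙ F ≅ Q), NatTrans.CommShift η.hom ℤ := by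
  let := E.commShiftInverse ℤ
  have := E.commShift_of_functor ℤ
  let η : E.functor ⋙ E.inverse ⋙ Q ≅ Q :=
    (Functor.associator _ _ _).symm ≪≫ Functor.isoWhiskerRight E.unitIso.symm Q ≪≫ Q.leftUnitor
  have : NatTrans.CommShift η.hom ℤ := by
    have : NatTrans.CommShift (Functor.isoWhiskerRight E.unitIso.symm Q).hom ℤ :=
      inferInstanceAs (NatTrans.CommShift (Functor.whiskerRight E.unitIso.inv Q) ℤ)
    dsimp only [η, Iso.trans_hom, Iso.symm_hom]
    infer_instance
  exact ⟨E.inverse ⋙ Q, inferInstance, η, this⟩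

lemma comp_eq_of_eq_id {C : Type*} [Category* C] {X Y Z : C} {p : X ⟶ X} {a : X ⟶ Y} {b : Y ⟶ Z}
    {c : X ⟶ Z} {q : Z ⟶ Z} (h : (p ≫ a) ≫ b = c ≫ q) (hp : p = 𝟙 X) (hq : q = 𝟙 Z) :
    a ≫ b = c := by
  simpa [hp, hq] using h

end

section

variable {C : Type u} [Category.{v} C] [HasShift C ℤ]

lemma shiftFunctorZero_hom_comp_map_comp_inv {X Y : C} (f : X ⟶ Y) :
    (shiftFunctorZero C ℤ).hom.app X ≫ f ≫ (shiftFunctorZero C ℤ).inv.app Y =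
      f⟦(0 : ℤ)⟧' := by
  have h := (shiftFunctorZero C ℤ).inv.naturality f
  simp only [Functor.id_map, Functor.id_obj] at h
  rw [h, Iso.hom_inv_id_app_assoc]

lemma shiftFunctorZero_hom_comp_shift {X Y : C} (e : X ⟶ Y⟦(1 : ℤ)⟧) (h : (1 : ℤ) + 0 = 0 + 1) :
    (shiftFunctorZero C ℤ).hom.app X ≫ e ≫ ((shiftFunctorZero C ℤ).inv.app Y)⟦(1 : ℤ)⟧' ≫
      (shiftFunctorAdd C 0 (1 : ℤ)).inv.app Y =
      e⟦(0 : ℤ)⟧' ≫ (shiftFunctorAdd' C 1 0 (0 + 1) h).inv.app Y := by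
  rw [← shiftFunctorZero_hom_comp_map_comp_inv, assoc, assoc]
  congr 2
  rw [shiftFunctorAdd_zero_add_inv_app, ← Functor.map_comp_assoc, Iso.inv_hom_id_app]
  simp [shiftFunctorAdd', shiftFunctorAdd_add_zero_inv_app]

end

section

variable {A : Type u'} [Category.{v'} A] [Abelian A]
  {D : Type u} [Category.{v} D] [Preadditive D] [HasZeroObject D] [HasShift D ℤ]
  [∀ n : ℤ, (shiftFunctor D n).Additive] [Pretriangulated D]
  {T : Type w} [Category.{w'} T] [Preadditive T] [HasZeroObject T] [HasShift T ℤ]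
  [∀ n : ℤ, (shiftFunctor T n).Additive] [Pretriangulated T]
  (i : A ⥤ D) (j : A ⥤ T)

/-- The decomposition of an object with a single summand in degree zero. -/
def Decomp.single (X : D) : Decomp X (fun _ : Unit => X⟦(0 : ℤ)⟧) where
  ι _ := (shiftFunctorZero D ℤ).hom.app X
  π _ := (shiftFunctorZero D ℤ).inv.app X
  ι_π_self _ := Iso.hom_inv_id_app _ _
  ι_π_ne _ _ h := (h rfl).elim
  total := by simp

namespace Matched

/-- The matched pair given by an object of the heart. -/
def ofHeart (X : A) : Matched i j where
  fst := i.obj X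
  snd := j.obj X
  J := Unit
  obj _ := X
  deg _ := 0
  decomp₁ := Decomp.single (i.obj X)
  decomp₂ := Decomp.single (j.obj X)

lemma homRel_ofHeart {X Y : A} (f : X ⟶ Y) :
    HomRel (ofHeart i j X) (ofHeart i j Y) (i.map f) (j.map f) := by
  intro _ _
  have := ShiftRel.map (i := i) (j := j) f (rfl : (0 : ℤ) = 0)
  rw [eqToHom_refl, eqToHom_refl, comp_id, comp_id, ← shiftFunctorZero_hom_comp_map_comp_inv,
    ← shiftFunctorZero_hom_comp_map_comp_inv] at this
  exact this

lemma homRel_of_extRel {X Y : A} {e : i.obj X ⟶ (i.obj Y)⟦(1 : ℤ)⟧}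
    {e' : j.obj X ⟶ (j.obj Y)⟦(1 : ℤ)⟧} (h : ExtRel i j e e') :
    HomRel (ofHeart i j X) ((ofHeart i j Y).shiftObj 1) e e' := by
  intro _ _
  have := ShiftRel.of_extRel h (n := 0) (m := 0 + 1) (by simp)
  rw [← shiftFunctorZero_hom_comp_shift, ← shiftFunctorZero_hom_comp_shift] at this
  exact this

variable [hi : Fact (IsHereditaryHeartInclusion i)] [hj : Fact (IsHereditaryHeartInclusion j)]

/-- The heart as a subcategory of the matched pairs. -/
def heartFunctor : A ⥤ Matched i j where
  obj := ofHeart i j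
  map f := ⟨i.map f, j.map f, homRel_ofHeart i j f⟩
  map_id _ := Hom.ext (i.map_id _) (j.map_id _)
  map_comp _ _ := Hom.ext (i.map_comp _ _) (j.map_comp _ _)

lemma toFst_essSurj (h : addClosure (unionShifts i.essImage) = ⊤) : (toFst i j).EssSurj where
  mem_essImage U := by
    have hU : addClosure (unionShifts i.essImage) U := by rw [h]; trivial
    obtain ⟨J, _, Z, m, d, hZ⟩ := (addClosure_unionShifts_iff _ _).1 hU
    choose X e using hZ
    let d₁ : Decomp U (fun a => (i.obj (X a))⟦m a⟧) :=
      d.ofIso (Iso.refl _) (fun a => (shiftFunctor D (m a)).mapIso (e a).some)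
    exact ⟨⟨U, ⨁ (fun a => (j.obj (X a))⟦m a⟧), J, X, m, d₁, .biproduct _⟩, ⟨Iso.refl _⟩⟩

lemma toSnd_essSurj (h : addClosure (unionShifts j.essImage) = ⊤) : (toSnd i j).EssSurj where
  mem_essImage U := by
    have hU : addClosure (unionShifts j.essImage) U := by rw [h]; trivial
    obtain ⟨J, _, Z, m, d, hZ⟩ := (addClosure_unionShifts_iff _ _).1 hU
    choose X e using hZ
    let d₂ : Decomp U (fun a => (j.obj (X a))⟦m a⟧) :=
      d.ofIso (Iso.refl _) (fun a => (shiftFunctor T (m a)).mapIso (e a).some)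
    exact ⟨⟨⨁ (fun a => (i.obj (X a))⟦m a⟧), U, J, X, m, .biproduct _, d₂⟩, ⟨Iso.refl _⟩⟩

section

variable {i j} (F : D ⥤ T) [F.CommShift ℤ] (η : toFst i j ⋙ F ≅ toSnd i j)

lemma shift_app_comm [NatTrans.CommShift η.hom ℤ] (r : Matched i j) (k : ℤ) :
    (F.commShiftIso k).hom.app r.fst ≫ (show F.obj r.fst ⟶ r.snd from η.hom.app r)⟦k⟧' =
      (show F.obj (r.fst⟦k⟧) ⟶ r.snd⟦k⟧ from η.hom.app (r.shiftObj k)) := by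
  have h := NatTrans.shift_app_comm η.hom k r
  rw [Functor.commShiftIso_comp_hom_app] at h
  exact comp_eq_of_eq_id h (F.map_id _) rfl

lemma naturality_of_homRel {r s : Matched i j} {f : r.fst ⟶ s.fst} {g : r.snd ⟶ s.snd}
    (h : HomRel r s f g) :
    F.map f ≫ (show F.obj s.fst ⟶ s.snd from η.hom.app s) =
      (show F.obj r.fst ⟶ r.snd from η.hom.app r) ≫ g :=
  η.hom.naturality (show r ⟶ s from ⟨f, g, h⟩)

/-- The short exact sequence has a class `e'` in `T`. Naturality of `η` at the matched morphism `(e,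
e')` identifies the image triangle with the one in `T`; compatibility of `η` with shifts is needed
for the last square. -/
lemma mapDist_of_extRel [NatTrans.CommShift η.hom ℤ] {X Y Z : A} (f : X ⟶ Y) (g : Y ⟶ Z)
    (e : i.obj Z ⟶ (i.obj X)⟦(1 : ℤ)⟧) (H : Dist (i.map f) (i.map g) e) :
    MapDist F (i.map f) (i.map g) e := by
  obtain ⟨w, hw⟩ := hi.out.shortExact H
  obtain ⟨e', H'⟩ := hj.out.ses f g w hw
  have h : ExtRel i j e e' := ⟨Y, f, g, H, H'⟩
  let α (W : A) : F.obj (i.obj W) ≅ j.obj W := η.app (ofHeart i j W)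
  refine Dist.of_iso H' (α X) (α Y) (α Z) ?_ ?_ ?_
  · exact naturality_of_homRel F η (homRel_ofHeart i j f)
  · exact naturality_of_homRel F η (homRel_ofHeart i j g)
  · rw [assoc]
    have h₁ := naturality_of_homRel F η (homRel_of_extRel i j h)
    rw [← shift_app_comm] at h₁
    exact h₁

lemma exactOnHeart [NatTrans.CommShift η.hom ℤ] (t : TStructure D)
    (ht : ∀ X, t.heart X ↔ i.essImage X) : ExactOnHeart F t := by
  intro X Y Z f g h H hX hY hZ
  obtain ⟨X', ⟨eX⟩⟩ := (ht X).1 hX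
  obtain ⟨Y', ⟨eY⟩⟩ := (ht Y).1 hY
  obtain ⟨Z', ⟨eZ⟩⟩ := (ht Z).1 hZ
  have := hi.out.full
  obtain ⟨f', hf'⟩ := i.map_surjective (eX.hom ≫ f ≫ eY.inv)
  obtain ⟨g', hg'⟩ := i.map_surjective (eY.hom ≫ g ≫ eZ.inv)
  have key : Dist (i.map f') (i.map g') (eZ.hom ≫ h ≫ eX.inv⟦(1 : ℤ)⟧') := by
    refine Dist.of_iso H eX eY eZ (by simp [hf']) (by simp [hg']) ?_
    rw [assoc, assoc, ← Functor.map_comp, eX.inv_hom_id, CategoryTheory.Functor.map_id, comp_id]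
  refine (mapDist_of_extRel F η f' g' _ key).of_iso eX.symm eY.symm eZ.symm
    (by simp [hf']) (by simp [hg']) (by simp)

end

end Matched

/-- Two triangulated categories which are generated by the same hereditary heart are equivalent. -/
theorem exists_triangleEquivalence [CategoryTheory.IsTriangulated D]
    [CategoryTheory.IsTriangulated T] (hi : IsHereditaryHeartInclusion i)
    (hj : IsHereditaryHeartInclusion j) (t : TStructure D)
    (ht : ∀ X, t.heart X ↔ i.essImage X) (hgap : HomGap t) (hb : IsBounded t)
    (hT : addClosure (unionShifts j.essImage) = ⊤) :
    ∃ (F : D ⥤ T) (_ : F.CommShift ℤ),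
      F.IsTriangulated ∧ F.IsEquivalence ∧ Nonempty (i ⋙ F ≅ j) := by
  have : Fact (IsHereditaryHeartInclusion i) := ⟨hi⟩
  have : Fact (IsHereditaryHeartInclusion j) := ⟨hj⟩
  have hD : addClosure (unionShifts i.essImage) = ⊤ := by
    rw [← show t.heart = i.essImage from by ext X; exact ht X]
    exact hgap.addClosure_eq_top hb
  have := Matched.toFst_essSurj i j hD
  have := Matched.toSnd_essSurj i j hT
  have h₁ : (Matched.toFst i j).IsEquivalence := { }
  have h₂ : (Matched.toSnd i j).IsEquivalence := { }
  obtain ⟨F, _, η, hη⟩ : ∃ (F : D ⥤ T) (_ : F.CommShift ℤ)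
      (η : Matched.toFst i j ⋙ F ≅ Matched.toSnd i j), NatTrans.CommShift η.hom ℤ :=
    @exists_factorization _ _ _ _ _ _ _ _ _ (Matched.toFst i j).asEquivalence
      (inferInstance : (Matched.toFst i j).CommShift ℤ) (Matched.toSnd i j) _
  have : (Matched.toFst i j ⋙ F).IsEquivalence := Functor.isEquivalence_of_iso η.symm
  have hF : F.IsEquivalence := Functor.isEquivalence_of_comp_left (Matched.toFst i j) F
  have : F.Additive := F.additive_of_preserves_binary_products
  refine ⟨F, inferInstance, (Matched.exactOnHeart F η t ht).isTriangulated hgap hb, hF, ⟨?_⟩⟩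
  exact Functor.isoWhiskerLeft (Matched.heartFunctor i j) η

end

/-! ### Transport of generation along functors. -/

section

variable {C : Type u} [Category.{v} C] [Preadditive C] [HasZeroObject C] [HasShift C ℤ]
  [∀ n : ℤ, (shiftFunctor C n).Additive] [Pretriangulated C]
  {T : Type w} [Category.{w'} T] [Preadditive T] [HasZeroObject T] [HasShift T ℤ]
  [∀ n : ℤ, (shiftFunctor T n).Additive] [Pretriangulated T]

lemma addClosure_of_iso {P : ObjectProperty C} {X Y : C} (e : X ≅ Y) (h : addClosure P Y) :
    addClosure P X := by
  obtain ⟨k, Z, hZ, ⟨e'⟩⟩ := h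
  exact ⟨k, Z, hZ, ⟨e ≪≫ e'⟩⟩

lemma addClosure_unionShifts_map (F : C ⥤ T) [F.CommShift ℤ] [F.Additive]
    {P : ObjectProperty C} {Q : ObjectProperty T} (h : ∀ X, P X → Q (F.obj X)) {X : C}
    (hX : addClosure (unionShifts P) X) : addClosure (unionShifts Q) (F.obj X) := by
  obtain ⟨J, _, Z, m, d, hZ⟩ := (addClosure_unionShifts_iff _ _).1 hX
  exact (addClosure_unionShifts_iff _ _).2 ⟨J, inferInstance, fun a => F.obj (Z a), m,
    (d.map F).ofIso (Iso.refl _) (fun a => ((F.commShiftIso (m a)).app (Z a)).symm),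
    fun a => h _ (hZ a)⟩

lemma addClosure_unionShifts_eq_top_of_equivalence (F : C ⥤ T) [F.CommShift ℤ] [F.IsEquivalence]
    {P : ObjectProperty C} {Q : ObjectProperty T} (h : ∀ X, P X → Q (F.obj X))
    (hP : addClosure (unionShifts P) = ⊤) : addClosure (unionShifts Q) = ⊤ := by
  have : F.Additive := F.additive_of_preserves_binary_products
  ext X
  refine ⟨fun _ => trivial, fun _ => ?_⟩
  refine addClosure_of_iso (F.objObjPreimageIso X).symm (addClosure_unionShifts_map F h ?_)
  rw [hP]
  trivial

lemma HomNegZero.essImage (F : C ⥤ T) [F.CommShift ℤ] [F.Full] [F.Additive]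
    {A : Type u'} [Category.{v'} A] (i : A ⥤ C)
    (h : ∀ (X Y : A) (n : ℤ) (_ : n < 0) (f : i.obj X ⟶ (i.obj Y)⟦n⟧), f = 0) :
    HomNegZero (i ⋙ F).essImage := by
  rintro X Y ⟨X', ⟨eX⟩⟩ ⟨Y', ⟨eY⟩⟩ n hn f
  have key (f : F.obj (i.obj X') ⟶ (F.obj (i.obj Y'))⟦n⟧) : f = 0 := by
    obtain ⟨g, hg⟩ := F.map_surjective (f ≫ (F.commShiftIso n).inv.app (i.obj Y'))
    rw [h _ _ n hn g, F.map_zero] at hg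
    rw [← cancel_mono ((F.commShiftIso n).inv.app (i.obj Y')), ← hg, zero_comp]
  rw [← cancel_epi eX.hom, ← cancel_mono (eY.inv⟦n⟧'), comp_zero, zero_comp]
  exact key _

end

/-! ### Derived categories of hereditary categories and split t-structures. -/

section

variable {A : Type u'} [Category.{v'} A] [Abelian A]
  {T : Type u} [Category.{v} T] [Preadditive T] [HasZeroObject T] [HasShift T ℤ]
  [∀ n : ℤ, (shiftFunctor T n).Additive] [Pretriangulated T]

lemma Db.addClosure_eq_top (hA : IsHereditary A) :
    addClosure (unionShifts (Db.single A).essImage) = ⊤ := by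
  rw [← show (Db.t A).heart = (Db.single A).essImage from by ext X; exact Db.heart_iff A X]
  exact (Db.homGap A hA).addClosure_eq_top (Db.isBounded A)

/-- A triangulated category which is equivalent to the bounded derived category of a hereditary
abelian category has a split bounded t-structure. -/
theorem exists_tStructure_of_isTriangleEquivalentToDb (hA : IsHereditary A)
    (h : IsTriangleEquivalentToDb T A) : ∃ t : TStructure T, IsSplit t ∧ IsBounded t := by
  obtain ⟨F, _, hF, _⟩ := h
  have : F.Additive := F.additive_of_preserves_binary_products
  -- The t-structure is not transported along `F` but generated anew by the image of `A`.
  have hH : HomNegZero (Db.single A ⋙ F).essImage :=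
    HomNegZero.essImage F (Db.single A)
      (fun _ _ _ hn f => (Db.single_isHeartInclusion A).hom_neg f hn)
  have hgen : addClosure (unionShifts (Db.single A ⋙ F).essImage) = ⊤ := by
    refine addClosure_unionShifts_eq_top_of_equivalence F ?_ (Db.addClosure_eq_top hA)
    rintro X ⟨Y, ⟨e⟩⟩
    exact ⟨Y, ⟨F.mapIso e⟩⟩
  exact ⟨genTStructure hH hgen, genTStructure_isSplit hH hgen, genTStructure_isBounded hH hgen⟩

lemma LiftsToTriangleEquivalence.addClosure_eq_top {i : A ⥤ T} (hA : IsHereditary A)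
    (h : LiftsToTriangleEquivalence i) {H : ObjectProperty T} [H.IsClosedUnderIsomorphisms]
    (hi : ∀ X, H (i.obj X)) : addClosure (unionShifts H) = ⊤ := by
  obtain ⟨F, _, hF, _, ⟨e⟩⟩ := h
  refine addClosure_unionShifts_eq_top_of_equivalence F ?_ (Db.addClosure_eq_top hA)
  rintro X ⟨Y, ⟨e'⟩⟩
  exact H.prop_of_iso ((e.app Y).symm ≪≫ F.mapIso e') (hi Y)

variable [CategoryTheory.IsTriangulated T]

lemma IsHereditaryHeartInclusion.of_homGap (t : TStructure T) (i : A ⥤ T) [i.Full] [i.Faithful]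
    [i.Additive] (h : ∀ X, t.heart X ↔ i.essImage X) (ht : HomGap t) :
    IsHereditaryHeartInclusion i where
  toIsHeartInclusion := .of_heart t i h
  hom_two X Y n f hn := by
    have h₁ := ((t.mem_heart_iff _).1 ((h _).2 (i.obj_mem_essImage X))).2
    have h₂ := ((t.mem_heart_iff _).1 ((h _).2 (i.obj_mem_essImage Y))).1
    exact ht f 0 (-n) h₁ (t.isLE_shift (i.obj Y) 0 n (-n)) (by lia)

/-- If an abelian category is the heart of a split bounded t-structure, then it is hereditary and
its inclusion lifts to a triangle equivalence from its bounded derived category. -/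
theorem isHereditary_and_liftsToTriangleEquivalence (t : TStructure T) (i : A ⥤ T) [i.Full]
    [i.Faithful] [i.Additive] (h : ∀ X, t.heart X ↔ i.essImage X) (hs : IsSplit t)
    (hb : IsBounded t) : IsHereditary A ∧ LiftsToTriangleEquivalence i := by
  have hgap := hs.homGap
  have hi := IsHereditaryHeartInclusion.of_homGap t i h hgap
  have hA : IsHereditary A :=
    hi.toIsHeartInclusion.isHereditary i (fun _ _ f => hi.hom_two f le_rfl)
  refine ⟨hA, ?_⟩
  have h₀ : IsHereditaryHeartInclusion (Db.single A) :=
    .of_homGap (Db.t A) _ (Db.heart_iff A) (Db.homGap A hA)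
  refine exists_triangleEquivalence (Db.single A) i h₀ hi (Db.t A) (Db.heart_iff A)
    (Db.homGap A hA) (Db.isBounded A) ?_
  rw [← show t.heart = i.essImage from by ext X; exact h X]
  exact hgap.addClosure_eq_top hb

end

/-! ### The heart as an abelian category. -/

section

variable {T : Type u} [Category.{v} T] [Preadditive T] [HasZeroObject T] [HasShift T ℤ]
  [∀ n : ℤ, (shiftFunctor T n).Additive] [Pretriangulated T] [CategoryTheory.IsTriangulated T]

lemma heart_iff_ι_essImage (t : TStructure T) (X : T) : t.heart X ↔ t.heart.ι.essImage X := by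
  constructor
  · intro hX
    exact ⟨⟨X, hX⟩, ⟨Iso.refl _⟩⟩
  · rintro ⟨Y, ⟨e⟩⟩
    exact t.heart.prop_of_iso e Y.property

lemma Decomp.heart {t : TStructure T} {X : T} {J : Type} [Fintype J] {Y : J → T}
    (d : Decomp X Y) (h : ∀ a, t.heart (Y a)) : t.heart X := by
  simp only [t.mem_heart_iff] at h
  rw [t.mem_heart_iff, t.isLE_iff_orthogonal 0 1 (by simp), t.isGE_iff_orthogonal (-1) 0 (by simp)]
  refine ⟨fun W f _ => d.hom_ext' (fun a => ?_), fun W f _ => d.hom_ext (fun a => ?_)⟩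
  · have := (h a).1
    rw [comp_zero]
    exact t.zero _ 0 1
  · have := (h a).2
    rw [zero_comp]
    exact t.zero _ (-1) 0

instance (t : TStructure T) : t.heart.IsClosedUnderFiniteProducts where
  isClosedUnderLimitsOfShape J _ := by
    refine ⟨?_⟩
    rintro X ⟨p⟩
    have := Fintype.ofFinite J
    let e : X ≅ ⨁ (p.diag.obj ∘ Discrete.mk) :=
      p.isLimit.conePointUniqueUpToIso (limit.isLimit _) ≪≫
        HasLimit.isoOfNatIso Discrete.natIsoFunctor ≪≫ (biproduct.isoProduct _).symm
    exact ((Decomp.biproduct _).ofIso e (fun a => Iso.refl _)).heart (fun a => p.prop_diag_obj ⟨a⟩)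

/-- The heart of a split bounded t-structure is a hereditary abelian category whose inclusion
lifts to a triangle equivalence from its bounded derived category. -/
theorem exists_abelian_heart (t : TStructure T) (hs : IsSplit t) (hb : IsBounded t) :
    ∃ inst : Abelian t.heart.FullSubcategory,
      inst.toPreadditive = Preadditive.fullSubcategory t.heart ∧
      IsHereditary t.heart.FullSubcategory ∧ LiftsToTriangleEquivalence t.heart.ι := by
  let inst : Abelian t.heart.FullSubcategory :=
    AbelianSubcategory.abelian t.heart.ι
      (IsHeartInclusion.hom_neg_of_heart t _ (heart_iff_ι_essImage t))
      (IsHeartInclusion.admissible t _ (heart_iff_ι_essImage t))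
  -- The abelian structure is built on the induced preadditive one, so the two agree definitionally.
  have h : inst.toPreadditive = Preadditive.fullSubcategory t.heart := rfl
  have : @Functor.Additive _ _ _ _ inst.toPreadditive _ t.heart.ι := by
    rw [h]
    infer_instance
  exact ⟨inst, h, isHereditary_and_liftsToTriangleEquivalence t t.heart.ι
    (heart_iff_ι_essImage t) hs hb⟩

end

end HereditaryDerived

/-! ### The main theorem. -/

theorem mainTheorem2 {T : Type u} [Category.{v} T] [Preadditive T] [HasZeroObject T]
    [HasShift T ℤ] [∀ n : ℤ, (shiftFunctor T n).Additive] [Pretriangulated T]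
    [CategoryTheory.IsTriangulated T] :
    -- the three equivalent conditions on a full additive subcategory `H`
    (∀ H : ObjectProperty T, H.IsClosedUnderFiniteProducts →
      (∀ (X Y : T), H X → H Y → ∀ n : ℤ, 0 < n → ∀ f : X ⟶ Y⟦-n⟧, f = 0) →
      List.TFAE [
        ∃ inst : Abelian H.FullSubcategory,
          inst.toPreadditive = Preadditive.fullSubcategory H ∧
          HereditaryDerived.IsHereditary H.FullSubcategory ∧
          HereditaryDerived.LiftsToTriangleEquivalence H.ι,
        HereditaryDerived.addClosure (HereditaryDerived.unionShifts H) = ⊤,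
        ∃ t : TStructure T, HereditaryDerived.IsSplit t ∧ HereditaryDerived.IsBounded t ∧
          H = t.heart]) ∧
    -- `T ≌ D^b(A)` with `A` hereditary abelian if and only if there is a split bounded t-structure
    ((∃ (A : Type u) (_ : Category.{v} A) (_ : Abelian A),
        HereditaryDerived.IsHereditary A ∧ HereditaryDerived.IsTriangleEquivalentToDb T A) ↔
      ∃ t : TStructure T, HereditaryDerived.IsSplit t ∧ HereditaryDerived.IsBounded t) ∧
    -- the forward implication also holds for `A` in arbitrary universes
    (∀ (A : Type u') [Category.{v'} A] [Abelian A],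
      HereditaryDerived.IsHereditary A → HereditaryDerived.IsTriangleEquivalentToDb T A →
      ∃ t : TStructure T, HereditaryDerived.IsSplit t ∧ HereditaryDerived.IsBounded t) := by
  refine ⟨fun H hc hneg => ?_, ⟨?_, ?_⟩, fun A _ _ hA h =>
    HereditaryDerived.exists_tStructure_of_isTriangleEquivalentToDb hA h⟩
  · tfae_have 1 → 2 := by
      rintro ⟨inst, -, hA, hF⟩
      have := ObjectProperty.IsClosedUnderBinaryProducts.closedUnderIsomorphisms H
      exact hF.addClosure_eq_top hA (fun X => X.property)
    tfae_have 2 → 3 := by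
      intro hgen
      have hH : HereditaryDerived.HomNegZero H := by
        intro X Y hX hY n hn f
        obtain ⟨m, rfl⟩ : ∃ m : ℤ, n = -m := ⟨-n, by simp⟩
        exact hneg X Y hX hY m (by lia) f
      exact ⟨HereditaryDerived.genTStructure hH hgen,
        HereditaryDerived.genTStructure_isSplit hH hgen,
        HereditaryDerived.genTStructure_isBounded hH hgen,
        (HereditaryDerived.genTStructure_heart hH hgen hc).symm⟩
    tfae_have 3 → 1 := by
      rintro ⟨t, hs, hb, rfl⟩
      exact HereditaryDerived.exists_abelian_heart t hs hb
    tfae_finish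
  · rintro ⟨A, _, _, hA, h⟩
    exact HereditaryDerived.exists_tStructure_of_isTriangleEquivalentToDb hA h
  · rintro ⟨t, hs, hb⟩
    obtain ⟨inst, -, hA, F, c, h₁, h₂, -⟩ := HereditaryDerived.exists_abelian_heart t hs hb
    -- The heart is a full subcategory of `T`, so it lives in the universes of `T`.
    exact ⟨t.heart.FullSubcategory, inferInstance, inst, hA, F, c, h₁, h₂⟩
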